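/- Let $k$ be a field. For a finite group $\Gamma$, an element $g\in\Gamma$ with centralizer $\Gamma_g$, and a representation $\rho$ of $\Gamma_g$ on $W$, let $M(g,\rho)=k\Gamma\otimes_{k\Gamma_g}W$ be the Yetter--Drinfeld module over $k\Gamma$ with action $h\cdot(x\otimes w)=hx\otimes w$ and coaction $\delta(x\otimes w)=xgx^{-1}\otimes(x\otimes w)$. The category of Yetter--Drinfeld modules over $k\Gamma$ has the braiding $c(m\otimes n)=m_{(-1)}n\otimes m_{(0)}$. For a Yetter--Drinfeld module $V$, $A(V)$ is the tensor algebra of $V$ with the braided Hopf algebra structure in which the elements of $V$ are primitive. A TOBA (Nichols algebra) is a graded Hopf algebra $R=\bigoplus_{n\ge0}R(n)$ in this category with $R(0)\simeq k$, $\bigl(\bigoplus_{i\ge1}R(i)\bigr)^2=\bigoplus_{i\ge2}R(i)$, and $P(R)=R(1)$, where $P(R)=\{x:\Delta(x)=1\otimes x+x\otimes1\}$. Let $D_3=\langle\rho,\sigma\mid\rho^3=\sigma^2=1,\ \sigma\rho=\rho^2\sigma\rangle$, let $\chi$ be the character of the centralizer $\{1,\sigma\}$ of $\sigma$ with $\chi(\sigma)=-1$,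 let $V=M(\sigma,\chi)$, $y_0=1\otimes1$ and $y_i=\rho^i\cdot y_0$ for $i\in\mathbb Z/3$. Let $R^2_3$ be the quotient of $A(V)$ by the ideal generated by $$y_i^2\ (i\in\mathbb Z/3),\qquad y_0y_1+y_1y_2+y_2y_0,\qquad y_0y_2+y_1y_0+y_2y_1.$$ Let $V'$ be the Yetter--Drinfeld module over $kS_3$ with basis $y_\tau$, $\tau$ running over the transpositions, with $\delta(y_\tau)=\tau\otimes y_\tau$ and $s\cdot y_\tau=\operatorname{sgn}(s)\,y_{s\tau s^{-1}}$. Let $R^1_3$ be the quotient of $A(V')$ by the ideal generated by $y_\tau^2$ for all $\tau$, $y_\tau y_{\tau'}+y_{\tau'}y_\tau$ whenever $\tau\tau'=\tau'\tau$, and $y_\tau y_{\tau'}+y_{\tau'}y_{\tau''}+y_{\tau''}y_\tau$ whenever $\tau\tau'=\tau''\tau$. Then $R^2_3$ and $R^1_3$, graded by the degree in the generators, inherit the braided Hopf algebra structures of $A(V)$ and $A(V')$ respectively. There are a group isomorphism $D_3\simeq S_3$ and an isomorphism $R^2_3\simeq R^1_3$ of graded algebras and coalgebras that is compatible, along this group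 isomorphism, with the actions and the coactions. Moreover $R^2_3$ is a TOBA of dimension $12$; its components of degrees $0,1,2,3,4$ have dimensions $1,3,4,3,1$, the components of degree $\ge5$ vanish, and $$1,\ y_0,\ y_1,\ y_2,\ y_0y_1,\ y_1y_2,\ y_0y_2,\ y_1y_0,\ y_0y_1y_0,\ y_0y_1y_2,\ y_1y_0y_2,\ y_0y_1y_0y_2$$ is a basis of $R^2_3$. -/

import Mathlib

open scoped TensorProduct

noncomputable section

namespace YetterDrinfeld

/-! ### Yetter-Drinfeld modules over a group algebra -/

section Modules

variable (k Γ : Type*) [Field k] [Group Γ]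

/-- A linear action of `Γ` and a linear map `M → kΓ ⊗ M`, without any compatibility. -/
structure YDData (M : Type*) [AddCommGroup M] [Module k M] where
  /-- The action `g ⇀ m`. -/
  act : Representation k Γ M
  /-- The coaction `δ(m) = m₍₋₁₎ ⊗ m₍₀₎`. -/
  coact : M →ₗ[k] MonoidAlgebra k Γ ⊗[k] M

/-- Conjugation `x ↦ h x h⁻¹` on the group algebra. -/
def conj (h : Γ) : MonoidAlgebra k Γ →ₗ[k] MonoidAlgebra k Γ :=
  LinearMap.mulLeft k (MonoidAlgebra.of k Γ h) ∘ₗ LinearMap.mulRight k (MonoidAlgebra.of k Γ h⁻¹)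

/-- A left Yetter-Drinfeld module (of any dimension) over the Hopf algebra `kΓ`: a left module
and left comodule with `δ(h m) = h₍₁₎ m₍₋₁₎ S(h₍₃₎) ⊗ h₍₂₎ m₍₀₎`. The latter condition is
linear in `h`, and for `h ∈ Γ` it reads `δ(h m) = h m₍₋₁₎ h⁻¹ ⊗ h m₍₀₎`. -/
structure YDModule (M : Type*) [AddCommGroup M] [Module k M] extends YDData k Γ M where
  coact_coassoc : (TensorProduct.assoc k _ _ M).toLinearMap ∘ₗ
      (Coalgebra.comul (R := k) (A := MonoidAlgebra k Γ)).rTensor M ∘ₗ coact =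
    coact.lTensor (MonoidAlgebra k Γ) ∘ₗ coact
  coact_counit : (Coalgebra.counit (R := k) (A := MonoidAlgebra k Γ)).rTensor M ∘ₗ coact =
    TensorProduct.mk k k M 1
  coact_act : ∀ h : Γ, coact ∘ₗ act h = TensorProduct.map (conj k Γ h) (act h) ∘ₗ coact

variable {k Γ}
variable {M N : Type*} [AddCommGroup M] [Module k M] [AddCommGroup N] [Module k N]

/-- The diagonal action and coaction on `M ⊗ N`:
`h (m ⊗ n) = h m ⊗ h n` and `δ(m ⊗ n) = m₍₋₁₎ n₍₋₁₎ ⊗ (m₍₀₎ ⊗ n₍₀₎)`. -/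
def YDData.tensor (A : YDData k Γ M) (B : YDData k Γ N) : YDData k Γ (M ⊗[k] N) where
  act := A.act.tprod B.act
  coact := (LinearMap.mul' k (MonoidAlgebra k Γ)).rTensor (M ⊗[k] N) ∘ₗ
    (TensorProduct.tensorTensorTensorComm k _ _ _ _).toLinearMap ∘ₗ
    TensorProduct.map A.coact B.coact

variable (k Γ) in
/-- The trivial action and coaction on `k`, the unit object. -/
def YDData.unit : YDData k Γ k where
  act := Representation.trivial k Γ k
  coact := TensorProduct.mk k (MonoidAlgebra k Γ) k 1

/-- The action map `kΓ ⊗ M → M`. -/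
def YDData.actMap (A : YDData k Γ M) : MonoidAlgebra k Γ ⊗[k] M →ₗ[k] M :=
  TensorProduct.lift A.act.asAlgebraHom.toLinearMap

/-- The braiding `c(m ⊗ n) = m₍₋₁₎ n ⊗ m₍₀₎`. -/
def YDData.braiding (A : YDData k Γ M) (B : YDData k Γ N) : M ⊗[k] N →ₗ[k] N ⊗[k] M :=
  B.actMap.rTensor M ∘ₗ
    (TensorProduct.assoc k (MonoidAlgebra k Γ) N M).symm.toLinearMap ∘ₗ
    (TensorProduct.comm k M N).toLinearMap.lTensor (MonoidAlgebra k Γ) ∘ₗ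
    (TensorProduct.assoc k (MonoidAlgebra k Γ) M N).toLinearMap ∘ₗ
    A.coact.rTensor N

/-- Morphisms of Yetter-Drinfeld modules: linear and colinear maps. -/
def IsYDHom (A : YDData k Γ M) (B : YDData k Γ N) (f : M →ₗ[k] N) : Prop :=
  (∀ g : Γ, f ∘ₗ A.act g = B.act g ∘ₗ f) ∧
    B.coact ∘ₗ f = f.lTensor (MonoidAlgebra k Γ) ∘ₗ A.coact

/-- Maps `M → N` that are equivariant and colinear along a group homomorphism `φ : Γ → Γ'`,
where `M` has an action and coaction of `kΓ` and `N` one of `kΓ'`. -/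
def IsYDHomAlong {Γ' : Type*} [Group Γ'] (φ : Γ →* Γ') (A : YDData k Γ M) (B : YDData k Γ' N)
    (f : M →ₗ[k] N) : Prop :=
  (∀ g : Γ, f ∘ₗ A.act g = B.act (φ g) ∘ₗ f) ∧
    B.coact ∘ₗ f =
      TensorProduct.map (MonoidAlgebra.mapDomainLinearMap k k φ) f ∘ₗ A.coact

end Modules

/-! ### Hopf algebras in the Yetter-Drinfeld category -/

section Hopf

variable (k Γ : Type*) [Field k] [Group Γ]

variable {k Γ} in
/-- The product `(m ⊗ m)(id ⊗ c ⊗ id)` on `R ⊗ R`. -/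
def YDData.braidedMul {R : Type*} [Ring R] [Algebra k R] (A : YDData k Γ R) :
    (R ⊗[k] R) ⊗[k] (R ⊗[k] R) →ₗ[k] R ⊗[k] R :=
  TensorProduct.map (LinearMap.mul' k R) (LinearMap.mul' k R) ∘ₗ
    (TensorProduct.assoc k R R (R ⊗[k] R)).symm.toLinearMap ∘ₗ
    ((TensorProduct.assoc k R R R).toLinearMap ∘ₗ
      (A.braiding A).rTensor R ∘ₗ
      (TensorProduct.assoc k R R R).symm.toLinearMap).lTensor R ∘ₗ
    (TensorProduct.assoc k R R (R ⊗[k] R)).toLinearMap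

/-- A Hopf algebra structure in the category of Yetter-Drinfeld modules over `kΓ` on a given
`k`-algebra `R`: all structure maps are morphisms of Yetter-Drinfeld modules, `R` is a coalgebra,
`ε` is multiplicative, `Δ m = (m ⊗ m)(id ⊗ c ⊗ id)(Δ ⊗ Δ)`, and the antipode is the convolution
inverse of the identity. -/
structure YDHopfAlgebra (R : Type*) [Ring R] [Algebra k R] extends
    YDModule k Γ R, Coalgebra k R where
  antipode : R →ₗ[k] R
  mul_hom : IsYDHom (toYDData.tensor toYDData) toYDData (LinearMap.mul' k R)
  unit_hom : IsYDHom (YDData.unit k Γ) toYDData (Algebra.linearMap k R)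
  comul_hom : IsYDHom toYDData (toYDData.tensor toYDData) comul
  counit_hom : IsYDHom toYDData (YDData.unit k Γ) counit
  antipode_hom : IsYDHom toYDData toYDData antipode
  counit_one : counit 1 = 1
  counit_mul : ∀ a b, counit (a * b) = counit a * counit b
  comul_one : comul 1 = 1 ⊗ₜ[k] 1
  comul_mul : comul ∘ₗ LinearMap.mul' k R =
    toYDData.braidedMul ∘ₗ TensorProduct.map comul comul
  antipode_left : LinearMap.mul' k R ∘ₗ antipode.rTensor R ∘ₗ comul =
    Algebra.linearMap k R ∘ₗ counit
  antipode_right : LinearMap.mul' k R ∘ₗ antipode.lTensor R ∘ₗ comul =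
    Algebra.linearMap k R ∘ₗ counit

variable {k Γ}
variable {R : Type*} [Ring R] [Algebra k R]

/-- The space `P(R) = {x | Δ(x) = 1 ⊗ x + x ⊗ 1}` of primitive elements. -/
def YDHopfAlgebra.primitives (T : YDHopfAlgebra k Γ R) : Submodule k R where
  carrier := {x | T.comul x = 1 ⊗ₜ[k] x + x ⊗ₜ[k] 1}
  zero_mem' := by simp
  add_mem' {x y} hx hy := by
    simp only [Set.mem_ofPred_eq] at hx hy ⊢
    rw [map_add, hx, hy, TensorProduct.tmul_add, TensorProduct.add_tmul]
    abel
  smul_mem' c x hx := by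
    simp only [Set.mem_ofPred_eq] at hx ⊢
    rw [map_smul, hx, smul_add, TensorProduct.tmul_smul, ← TensorProduct.smul_tmul' c x]

/-- `R = ⨁ 𝒜 n` is a graded Hopf algebra in the Yetter-Drinfeld category. -/
structure IsGradedHopf (T : YDHopfAlgebra k Γ R) (𝒜 : ℕ → Submodule k R) : Prop where
  isInternal : DirectSum.IsInternal 𝒜
  act_mem : ∀ n g, ∀ x ∈ 𝒜 n, T.act g x ∈ 𝒜 n
  coact_mem : ∀ n, ∀ x ∈ 𝒜 n,
    T.coact x ∈ LinearMap.range ((𝒜 n).subtype.lTensor (MonoidAlgebra k Γ))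
  mul_le : ∀ i j, 𝒜 i * 𝒜 j ≤ 𝒜 (i + j)
  comul_mem : ∀ n, ∀ x ∈ 𝒜 n, T.comul x ∈
    ⨆ ij ∈ Finset.HasAntidiagonal.antidiagonal n, LinearMap.range (TensorProduct.mapIncl (𝒜 ij.1) (𝒜 ij.2))

/-- A TOBA, or braided Hopf algebra of type one (a Nichols algebra): a graded Hopf algebra `R`
in the Yetter-Drinfeld category with `R(0) ≃ k`, `(⨁_{i ≥ 1} R(i))² = ⨁_{i ≥ 2} R(i)` and
`P(R) = R(1)`. -/
structure IsTOBA (T : YDHopfAlgebra k Γ R) (𝒜 : ℕ → Submodule k R) : Prop extends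
    IsGradedHopf T 𝒜 where
  zero_equiv : Nonempty (𝒜 0 ≃ₗ[k] k)
  sq_eq : (⨆ i, ⨆ _ : 1 ≤ i, 𝒜 i) ^ 2 = ⨆ i, ⨆ _ : 2 ≤ i, 𝒜 i
  primitives_eq : T.primitives = 𝒜 1

/-- Let `R` be a quotient algebra of the tensor algebra of a Yetter-Drinfeld module `V`, and
`j : V → R` the canonical map. A braided Hopf algebra structure on `R` is the one inherited from
`A(V)` (the tensor algebra in which the elements of `V` are primitive) if `j` is a morphism of
Yetter-Drinfeld modules with primitive values. As `R` is generated by the image of `j`, there is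
at most one such structure. -/
def YDHopfAlgebra.IsInherited {V : Type*} [AddCommGroup V] [Module k V] (T : YDHopfAlgebra k Γ R)
    (A : YDModule k Γ V) (j : V →ₗ[k] R) : Prop :=
  IsYDHom A.toYDData T.toYDData j ∧ ∀ v, j v ∈ T.primitives

end Hopf

/-! ### The modules `M(g, ρ)` -/

section Induced

variable {k Γ : Type*} [Field k] [Group Γ] (g : Γ)
variable {W : Type*} [AddCommGroup W] [Module k W]
  (ρ : Representation k (Subgroup.centralizer ({g} : Set Γ)) W)

/-- The space underlying `M(g, ρ) = kΓ ⊗_{kΓ_g} W`, for a representation `ρ` of the centralizer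
`Γ_g` on `W`. The element `x ⊗ w` is `Representation.IndV.mk _ ρ x⁻¹ w` (Mathlib's induced
representation lets `h` act by `[x ⊗ w] ↦ [x h⁻¹ ⊗ w]`). -/
abbrev MSpace : Type _ := Representation.IndV (Subgroup.centralizer ({g} : Set Γ)).subtype ρ

/-- The element `x ⊗ w` of `M(g, ρ)`. -/
def MSpace.tmul (x : Γ) (w : W) : MSpace g ρ :=
  Representation.IndV.mk (Subgroup.centralizer ({g} : Set Γ)).subtype ρ x⁻¹ w

/-- The coaction `δ(x ⊗ w) = x g x⁻¹ ⊗ (x ⊗ w)` of `M(g, ρ)`. -/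
def MSpace.coact : MSpace g ρ →ₗ[k] MonoidAlgebra k Γ ⊗[k] MSpace g ρ :=
  Representation.Coinvariants.lift _
    ((Representation.Coinvariants.mk _).lTensor (MonoidAlgebra k Γ) ∘ₗ
      (TensorProduct.assoc k (MonoidAlgebra k Γ) (MonoidAlgebra k Γ) W).toLinearMap ∘ₗ
      ((MonoidAlgebra.mapDomainLinearMap k k fun h : Γ => h⁻¹ * g * h).rTensor _ ∘ₗ
        Coalgebra.comul (R := k) (A := MonoidAlgebra k Γ)).rTensor W)
    (by
      rintro ⟨c, hc⟩
      have hc' : g * c = c * g := Subgroup.mem_centralizer_iff.mp hc g rfl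
      ext h w
      have h1 : h⁻¹ * c⁻¹ * g * (c * h) = h⁻¹ * g * h := by
        rw [show h⁻¹ * c⁻¹ * g * (c * h) = h⁻¹ * c⁻¹ * (g * c) * h by group, hc']
        group
      have h2 := Representation.Coinvariants.mk_self_apply (Representation.tprod
        ((Representation.leftRegular k Γ).comp (Subgroup.centralizer ({g} : Set Γ)).subtype) ρ)
        ⟨c, hc⟩ (MonoidAlgebra.single h 1 ⊗ₜ w)
      simp at h2
      simp [h1, h2])

theorem MSpace.coact_tmul (x : Γ) (w : W) :
    MSpace.coact g ρ (MSpace.tmul g ρ x w) =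
      MonoidAlgebra.of k Γ (x * g * x⁻¹) ⊗ₜ[k] MSpace.tmul g ρ x w := by
  simp [MSpace.coact, MSpace.tmul]

theorem MSpace.act_tmul (h x : Γ) (w : W) :
    Representation.ind (Subgroup.centralizer ({g} : Set Γ)).subtype ρ h (MSpace.tmul g ρ x w) =
      MSpace.tmul g ρ (h * x) w := by
  simp [MSpace.tmul]

theorem MSpace.hom_ext {N : Type*} [AddCommGroup N] [Module k N] {f f' : MSpace g ρ →ₗ[k] N}
    (h : ∀ x w, f (MSpace.tmul g ρ x w) = f' (MSpace.tmul g ρ x w)) : f = f' := by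
  refine Representation.IndV.hom_ext _ _ fun x => LinearMap.ext fun w => ?_
  have := h x⁻¹ w
  simp only [MSpace.tmul, inv_inv] at this
  exact this

/-- The Yetter-Drinfeld module `M(g, ρ)`, with the induced action `h (x ⊗ w) = h x ⊗ w` and the
coaction `δ(x ⊗ w) = x g x⁻¹ ⊗ (x ⊗ w)`. -/
def M : YDModule k Γ (MSpace g ρ) where
  act := Representation.ind (Subgroup.centralizer ({g} : Set Γ)).subtype ρ
  coact := MSpace.coact g ρ
  coact_coassoc := by
    apply MSpace.hom_ext
    intro x w
    simp [MSpace.coact_tmul]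
  coact_counit := by
    apply MSpace.hom_ext
    intro x w
    simp [MSpace.coact_tmul]
  coact_act h := by
    apply MSpace.hom_ext
    intro x w
    simp only [LinearMap.comp_apply, MSpace.act_tmul, MSpace.coact_tmul, TensorProduct.map_tmul]
    simp [conj, mul_assoc]

end Induced

/-! ### The algebras `R¹ₙ` -/

section SymmetricGroup

variable (k : Type*) [Field k] (n : ℕ)

/-- The (not only elementary) transpositions of the symmetric group. -/
abbrev Transposition : Type := {τ : Equiv.Perm (Fin n) // τ.IsSwap}

variable {n} in
/-- The conjugate `s τ s⁻¹` of a transposition. -/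
def Transposition.conj (s : Equiv.Perm (Fin n)) (τ : Transposition n) : Transposition n :=
  ⟨s * τ.1 * s⁻¹, by
    obtain ⟨τ, a, b, hab, rfl⟩ := τ
    exact ⟨s a, s b, fun h => hab (s.injective h), (Equiv.swap_apply_apply s a b).symm⟩⟩

/-- The Yetter-Drinfeld module over the group algebra of the symmetric group with basis `y_τ`
(`τ` a transposition), `δ(y_τ) = τ ⊗ y_τ` and `s y_τ = sgn(s) y_{s τ s⁻¹}`. -/
def V1 : YDModule k (Equiv.Perm (Fin n)) (Transposition n →₀ k) where
  act :=
    { toFun := fun s => ((Equiv.Perm.sign s : ℤ) : k) • Finsupp.lmapDomain k k (.conj s)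
      map_one' := by
        ext τ
        simp [Transposition.conj]
      map_mul' := fun s t => by
        ext τ : 2
        simp [Transposition.conj, mul_assoc, mul_comm] }
  coact := Finsupp.linearCombination k fun τ =>
    MonoidAlgebra.of k (Equiv.Perm (Fin n)) τ.1 ⊗ₜ[k] Finsupp.single τ 1
  coact_coassoc := by
    ext τ
    simp
  coact_counit := by
    ext τ
    simp
  coact_act s := by
    ext τ
    simp [YetterDrinfeld.conj, Transposition.conj, mul_assoc, ← TensorProduct.tmul_smul]

/-- The generator `y_τ` in the tensor algebra `A(V)`. -/
def t1 (τ : Transposition n) : TensorAlgebra k (Transposition n →₀ k) :=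
  TensorAlgebra.ι k (Finsupp.single τ 1)

/-- The defining relations of `R¹ₙ`. -/
inductive Rel1 : TensorAlgebra k (Transposition n →₀ k) →
    TensorAlgebra k (Transposition n →₀ k) → Prop
  | sq (τ : Transposition n) : Rel1 (t1 k n τ * t1 k n τ) 0
  | comm (τ τ' : Transposition n) (h : τ.1 * τ'.1 = τ'.1 * τ.1) :
      Rel1 (t1 k n τ * t1 k n τ' + t1 k n τ' * t1 k n τ) 0
  | braid (τ τ' τ'' : Transposition n) (h : τ.1 * τ'.1 = τ''.1 * τ.1) :
      Rel1 (t1 k n τ * t1 k n τ' + t1 k n τ' * t1 k n τ'' + t1 k n τ'' * t1 k n τ) 0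

/-- The algebra `R¹ₙ = A(V) / I`. -/
abbrev R1 : Type _ := RingQuot (Rel1 k n)

/-- The canonical map `V → R¹ₙ`. -/
def j1 : (Transposition n →₀ k) →ₗ[k] R1 k n :=
  (RingQuot.mkAlgHom k (Rel1 k n)).toLinearMap ∘ₗ TensorAlgebra.ι k

/-- The component of degree `d` of `R¹ₙ`, the image of `V^{⊗ d}`. -/
def grade1 (d : ℕ) : Submodule k (R1 k n) := LinearMap.range (j1 k n) ^ d

end SymmetricGroup

/-! ### The algebras `R²ₚ` -/

section Dihedral

variable (k : Type*) [Field k] (p : ℕ)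

/-- The character of the dihedral group with value `1` on rotations and `-1` on reflections. -/
def dihedralSign : DihedralGroup p →* k where
  toFun
    | .r _ => 1
    | .sr _ => -1
  map_one' := rfl
  map_mul' := by rintro (a | a) (b | b) <;> simp

/-- The reflection `σ`. With the rotation `ρ = r 1`, `ρ^p = σ² = 1` and `σ ρ = ρ^{p-1} σ`; the
power `ρ^i` is `r i`. -/
abbrev sigma : DihedralGroup p := .sr 0

/-- The one-dimensional representation `χ` of the centralizer of `σ` given by the restriction of
the sign; for odd `p` this centralizer is `{1, σ}` and `χ(σ) = -1`. -/
def chi : Representation k (Subgroup.centralizer ({sigma p} : Set (DihedralGroup p))) k :=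
  (Algebra.lmul k k).toMonoidHom.comp ((dihedralSign k p).comp (Subgroup.subtype _))

/-- The Yetter-Drinfeld module `V = M(σ, χ)`. -/
def V2 : YDModule k (DihedralGroup p) (MSpace (sigma p) (chi k p)) := M (sigma p) (chi k p)

/-- The element `y_i = ρ^i ⇀ y_0` of `V`, where `y_0 = 1 ⊗ 1`. -/
def v2 (i : ZMod p) : MSpace (sigma p) (chi k p) :=
  (V2 k p).act (.r i) (MSpace.tmul (sigma p) (chi k p) 1 1)

/-- The generator `y_i` in the tensor algebra `A(V)`. -/
def t2 (i : ZMod p) : TensorAlgebra k (MSpace (sigma p) (chi k p)) :=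
  TensorAlgebra.ι k (v2 k p i)

/-- The defining relations `y_i² = 0` and `∑ᵢ y_i y_{i+s} = 0` (`s ≠ 0`) of `R²ₚ`. -/
inductive Rel2 [NeZero p] : TensorAlgebra k (MSpace (sigma p) (chi k p)) →
    TensorAlgebra k (MSpace (sigma p) (chi k p)) → Prop
  | sq (i : ZMod p) : Rel2 (t2 k p i * t2 k p i) 0
  | sum (s : ZMod p) (hs : s ≠ 0) : Rel2 (∑ i : ZMod p, t2 k p i * t2 k p (i + s)) 0

variable [NeZero p]

/-- The algebra `R²ₚ = A(V) / I`. -/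
abbrev R2 : Type _ := RingQuot (Rel2 k p)

/-- The canonical map `V → R²ₚ`. -/
def j2 : MSpace (sigma p) (chi k p) →ₗ[k] R2 k p :=
  (RingQuot.mkAlgHom k (Rel2 k p)).toLinearMap ∘ₗ TensorAlgebra.ι k

/-- The generator `y_i` of `R²ₚ`. -/
def y (i : ZMod p) : R2 k p := j2 k p (v2 k p i)

/-- The component of degree `d` of `R²ₚ`, the image of `V^{⊗ d}`. -/
def grade2 (d : ℕ) : Submodule k (R2 k p) := LinearMap.range (j2 k p) ^ d

end Dihedral

end YetterDrinfeld

end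

/-! Both algebras have the same quadratic presentation: generators indexed by `ℤ/3`, with `y_i` of
degree the reflection (or transposition) fixing the vertex `i`, and relations `fkRels`. The action
of `D₃` on the vertices of the triangle identifies `D₃` with `S₃` and matches degrees, actions and
signs. Hence the universal property gives the isomorphism, and naturality of the construction makes
it compatible with all structure.

The Hopf structure comes from one general fact. Suppose the quadratic relations are homogeneous for
the coaction, stable under the group, and eigenvectors of the braiding `c` with eigenvalue `-1`. For
such a relation `r` the mixed part of `Δ(r)` is `(1 + c)(r) = 0`, so `r` is primitive and the
structure of `A(V)` descends. Concretely, `comulHom` lets `y_x` operate on `R ⊗ R` as left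
multiplication by `y_x ⊗ 1 + 1 ⊗ y_x` in the braided tensor product; the relations hold for these
operators, and `Δ(a)` is the value of the operator of `a` at `1 ⊗ 1`. The axioms then follow by
induction on words, adding one generator on the left.

For the basis, rewriting shows that the twelve monomials span (`gen_mul_fkMonomial_mem`). They are
independent because iterated skew derivations `∂_i = (id ⊗ coord i) Δ` followed by `ε` give a dual
family (`fkDual_fkMonomial`). The same functionals determine the primitives: on a primitive element
`ε` and every word of at least two derivations vanish, so only the coordinates of degree one survive
(`primitives_eq_span`). -/

open scoped TensorProduct

noncomputable section

namespace YetterDrinfeld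

universe u

/-! ### Algebras with a quadratic presentation -/

section Presentation

variable (k : Type u) [Field k] {X : Type*} {R : Type u} [Ring R] [Algebra k R]

/-- The `k`-algebra `R` is generated by the family `y`, subject to the quadratic relations
`∑_{(a, b) ∈ q} y a * y b = 0` for `q ∈ rels`. -/
structure IsQuadraticPresentation (rels : Set (Multiset (X × X))) (y : X → R) : Prop where
  sum_eq_zero : ∀ q ∈ rels, (q.map fun p => y p.1 * y p.2).sum = 0
  exists_lift : ∀ {B : Type u} [Ring B] [Algebra k B] (f : X → B),
    (∀ q ∈ rels, (q.map fun p => f p.1 * f p.2).sum = 0) → ∃ F : R →ₐ[k] B, ∀ x, F (y x) = f x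
  adjoin_eq_top : Algebra.adjoin k (Set.range y) = ⊤

namespace IsQuadraticPresentation

variable {k} {rels : Set (Multiset (X × X))} {y : X → R}
  (P : IsQuadraticPresentation k rels y)

/-- The algebra map extending a map on generators that satisfies the relations. -/
def lift {B : Type u} [Ring B] [Algebra k B] (f : X → B)
    (hf : ∀ q ∈ rels, (q.map fun p => f p.1 * f p.2).sum = 0) : R →ₐ[k] B :=
  (P.exists_lift f hf).choose

@[simp]
theorem lift_apply {B : Type u} [Ring B] [Algebra k B] (f : X → B)
    (hf : ∀ q ∈ rels, (q.map fun p => f p.1 * f p.2).sum = 0) (x : X) :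
    P.lift f hf (y x) = f x :=
  (P.exists_lift f hf).choose_spec x

include P in
theorem algHom_ext {B : Type*} [Ring B] [Algebra k B] {F G : R →ₐ[k] B}
    (h : ∀ x, F (y x) = G (y x)) : F = G := by
  refine AlgHom.ext_of_adjoin_eq_top P.adjoin_eq_top ?_
  rintro _ ⟨x, rfl⟩
  exact h x

include P in
/-- A subspace that contains `1` and is stable under left multiplication by the generators is
everything. -/
theorem eq_top_of_left_stable {N : Submodule k R} (h1 : 1 ∈ N)
    (hN : ∀ x, ∀ a ∈ N, y x * a ∈ N) : N = ⊤ := by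
  rw [eq_top_iff, ← Algebra.top_toSubmodule, ← P.adjoin_eq_top, Algebra.adjoin_eq_span,
    Submodule.span_le]
  intro a ha
  induction ha using Submonoid.closure_induction_left with
  | one => exact h1
  | mul_left x hx b _ ih =>
    obtain ⟨x, rfl⟩ := hx
    exact hN x b ih

-- This replaces induction on words: nearly every identity of linear maps on `R` below is checked at
-- `1` and then carried across left multiplication by a generator.
include P in
theorem linearMap_ext {M : Type*} [AddCommGroup M] [Module k M] {f g : R →ₗ[k] M}
    (h1 : f 1 = g 1) (h : ∀ x a, f a = g a → f (y x * a) = g (y x * a)) : f = g := by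
  have : LinearMap.eqLocus f g = ⊤ := P.eq_top_of_left_stable h1 h
  exact LinearMap.eqLocus_eq_top.1 this

include P in
theorem sum_map_eq_zero {M : Type*} [AddCommGroup M] [Module k M] (f : R →ₗ[k] M)
    {q : Multiset (X × X)} (hq : q ∈ rels) : (q.map fun p => f (y p.1 * y p.2)).sum = 0 := by
  have := map_multiset_sum f (q.map fun p => y p.1 * y p.2)
  rw [P.sum_eq_zero q hq, map_zero, Multiset.map_map] at this
  exact this.symm

/-- The augmentation, as an algebra map. -/
def counit : R →ₐ[k] k := P.lift (fun _ => 0) fun q _ => by simp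

@[simp]
theorem counit_gen (x : X) : P.counit (y x) = 0 := P.lift_apply _ _ _

section Coord

variable [DecidableEq X]

/-- The algebra map to the dual numbers that sends the generator `y x` to `ε` and the other
generators to `0`. -/
def dualNumberHom (x : X) : R →ₐ[k] DualNumber k :=
  P.lift (fun x' => if x' = x then DualNumber.eps else 0) fun q _ => by
    simp

theorem fst_dualNumberHom (x : X) (a : R) :
    TrivSqZeroExt.fst (P.dualNumberHom x a) = P.counit a := by
  have : (TrivSqZeroExt.fstHom k k k).comp (P.dualNumberHom x) = P.counit :=
    P.algHom_ext fun x' => by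
      by_cases h : x' = x <;> simp [dualNumberHom, h]
  exact DFunLike.congr_fun this a

/-- The coefficient of the generator `y x`. -/
def coord (x : X) : R →ₗ[k] k :=
  TrivSqZeroExt.sndHom k k ∘ₗ (P.dualNumberHom x).toLinearMap

theorem coord_one (x : X) : P.coord x 1 = 0 := by
  simp [coord]

theorem coord_gen (x x' : X) : P.coord x (y x') = if x' = x then 1 else 0 := by
  by_cases h : x' = x <;> simp [coord, dualNumberHom, h]

/-- The image of a generator in the dual numbers is a multiple of `ε`, so only the constant term of
`a` contributes. Thus `coord x` kills all products of two or more generators. -/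
theorem coord_gen_mul (x x' : X) (a : R) :
    P.coord x (y x' * a) = P.coord x (y x') * P.counit a := by
  simp [coord, fst_dualNumberHom, mul_comm]

end Coord

end IsQuadraticPresentation

end Presentation

/-! ### Combinatorial data for the Yetter-Drinfeld structure -/

section Datum

-- With `Γ` in `Type`, the algebra `kΓ ⊗ R` stays in the universe `u` in which `exists_lift`
-- provides maps.
variable (k : Type u) [Field k] (Γ : Type) [Group Γ] {X : Type*}

/-- An action of `Γ` on `X`, with degrees and a character, such that `g ⇀ y_x = χ(g) y_{g x}` and
`δ(y_x) = deg x ⊗ y_x` define a Yetter-Drinfeld module, together with a `Γ`-stable family of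
homogeneous quadratic relations fixed by the braiding up to the sign. -/
structure BraidedQuadraticDatum (rels : Set (Multiset (X × X))) where
  deg : X → Γ
  perm : Γ → X → X
  χ : Γ →* k
  perm_one : ∀ x, perm 1 x = x
  perm_mul : ∀ g h x, perm (g * h) x = perm g (perm h x)
  deg_perm : ∀ g x, deg (perm g x) = g * deg x * g⁻¹
  χ_deg : ∀ x, χ (deg x) = -1
  perm_rel : ∀ g, ∀ q ∈ rels, q.map (Prod.map (perm g) (perm g)) ∈ rels
  deg_rel : ∀ q ∈ rels, ∃ h, ∀ p ∈ q, deg p.1 * deg p.2 = h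
  -- Together with `χ_deg` this says `c(r) = -r` for every relation `r`, since `c(y_a ⊗ y_b) =
  -- -y_{deg a · b} ⊗ y_a`.
  braid_rel : ∀ q ∈ rels, q.map (fun p => (perm (deg p.1) p.2, p.1)) = q

end Datum

/-! ### Action, coaction, coproduct and antipode on a presented algebra -/

section Construction

variable {k : Type u} [Field k] {Γ : Type} [Group Γ] {X : Type*} {R : Type u} [Ring R]
  [Algebra k R] {rels : Set (Multiset (X × X))} {y : X → R}

namespace BraidedQuadraticDatum

variable (D : BraidedQuadraticDatum k Γ rels) (P : IsQuadraticPresentation k rels y)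

/-- The action of a group element, as an algebra map. -/
def actHom (g : Γ) : R →ₐ[k] R :=
  P.lift (fun x => D.χ g • y (D.perm g x)) fun q hq => by
    have := P.sum_eq_zero _ (D.perm_rel g q hq)
    rw [Multiset.map_map] at this
    simp only [smul_mul_smul_comm, Function.comp_def, Prod.map] at this ⊢
    rw [← Function.comp_def (fun b => (D.χ g * D.χ g) • b), ← Multiset.map_map,
      ← Multiset.smul_sum, this, smul_zero]

@[simp]
theorem actHom_apply (g : Γ) (x : X) : D.actHom P g (y x) = D.χ g • y (D.perm g x) :=
  P.lift_apply _ _ _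

/-- The action of `Γ` on the presented algebra. -/
def act : Representation k Γ R where
  toFun g := (D.actHom P g).toLinearMap
  map_one' := by
    have : D.actHom P 1 = AlgHom.id k R := P.algHom_ext fun x => by simp [D.perm_one]
    rw [this]
    rfl
  map_mul' g h := by
    have : D.actHom P (g * h) = (D.actHom P g).comp (D.actHom P h) :=
      P.algHom_ext fun x => by simp [D.perm_mul, smul_smul, mul_comm]
    rw [this]
    rfl

theorem act_gen (g : Γ) (x : X) : D.act P g (y x) = D.χ g • y (D.perm g x) :=
  D.actHom_apply P g x

theorem act_mul (g : Γ) (a b : R) : D.act P g (a * b) = D.act P g a * D.act P g b :=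
  map_mul (D.actHom P g) a b

theorem act_one (g : Γ) : D.act P g (1 : R) = 1 := map_one (D.actHom P g)

theorem act_act (g h : Γ) (a : R) : D.act P g (D.act P h a) = D.act P (g * h) a := by
  rw [map_mul]
  rfl

theorem act_deg_gen (x x' : X) : D.act P (D.deg x) (y x') = -y (D.perm (D.deg x) x') := by
  rw [act_gen, χ_deg, neg_one_smul]

/-- The coaction, as an algebra map. -/
def coact : R →ₐ[k] MonoidAlgebra k Γ ⊗[k] R :=
  P.lift (fun x => MonoidAlgebra.of k Γ (D.deg x) ⊗ₜ y x) fun q hq => by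
    obtain ⟨h, hh⟩ := D.deg_rel q hq
    rw [← P.sum_map_eq_zero (TensorProduct.mk k _ _ (MonoidAlgebra.of k Γ h)) hq]
    refine congrArg _ (Multiset.map_congr rfl fun p hp => ?_)
    rw [Algebra.TensorProduct.tmul_mul_tmul, ← map_mul, hh p hp]
    rfl

@[simp]
theorem coact_gen (x : X) : D.coact P (y x) = MonoidAlgebra.of k Γ (D.deg x) ⊗ₜ y x :=
  P.lift_apply _ _ _

theorem counit_act (g : Γ) (a : R) : P.counit (D.act P g a) = P.counit a := by
  have : P.counit.comp (D.actHom P g) = P.counit := P.algHom_ext fun x => by simp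
  exact DFunLike.congr_fun this a

/-- Left multiplication by the coproduct in the braided tensor product. -/
def comulHom : R →ₐ[k] Module.End k (R ⊗[k] R) :=
  P.lift (fun x => TensorProduct.map (LinearMap.mulLeft k (y x)) LinearMap.id +
    TensorProduct.map (D.act P (D.deg x)) (LinearMap.mulLeft k (y x))) fun q hq => by
    obtain ⟨h, hh⟩ := D.deg_rel q hq
    ext a b
    -- The mixed terms: reindexing the first sum by the braiding turns it into the negative of the
    -- second.
    have h1 : (q.map fun p => (y p.1 * D.act P (D.deg p.2) a) ⊗ₜ[k] (y p.2 * b)).sum +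
        (q.map fun p => (D.act P (D.deg p.1) (y p.2) * D.act P (D.deg p.1) a) ⊗ₜ[k]
          (y p.1 * b)).sum = 0 := by
      conv_lhs => enter [1]; rw [← D.braid_rel q hq]
      rw [Multiset.map_map, ← Multiset.sum_map_add]
      simp [act_deg_gen, TensorProduct.neg_tmul]
    -- The two unmixed terms are the relation itself in one tensor factor; in the second factor,
    -- homogeneity makes the twist of `a` the same `act h` for every pair.
    have h2 := P.sum_map_eq_zero (((TensorProduct.mk k R R).flip b) ∘ₗ LinearMap.mulRight k a) hq
    have h3 := P.sum_map_eq_zero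
      (TensorProduct.mk k R R (D.act P h a) ∘ₗ LinearMap.mulRight k b) hq
    rw [← add_zero (0 : R ⊗[k] R)] at h1
    have h4 := congrArg₂ (· + ·) (congrArg₂ (· + ·) h2 h1) h3
    simp only [← Multiset.sum_map_add, add_zero] at h4
    have h5 := map_multiset_sum (LinearMap.applyₗ (R := k) (M₂ := R ⊗[k] R) (a ⊗ₜ[k] b))
    simp only [TensorProduct.AlgebraTensorModule.curry_apply, LinearMap.restrictScalars_self,
      TensorProduct.curry_apply, LinearMap.zero_apply]
    refine ((h5 _).trans ?_).trans h4
    rw [Multiset.map_map]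
    refine congrArg _ (Multiset.map_congr rfl fun p hp => ?_)
    simp [← hh p hp, act_mul, mul_assoc]
    abel

theorem comulHom_gen (x : X) (a b : R) : D.comulHom P (y x) (a ⊗ₜ b) =
    (y x * a) ⊗ₜ b + D.act P (D.deg x) a ⊗ₜ (y x * b) := by
  simp [comulHom]

/-- The coproduct. -/
def comul : R →ₗ[k] R ⊗[k] R :=
  LinearMap.applyₗ (R := k) (M₂ := R ⊗[k] R) (1 ⊗ₜ 1) ∘ₗ (D.comulHom P).toLinearMap

theorem comul_one : D.comul P 1 = 1 ⊗ₜ 1 := by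
  simp [comul]

theorem comul_mul_eq (a b : R) : D.comul P (a * b) = D.comulHom P a (D.comul P b) := by
  simp [comul]

theorem comul_gen (x : X) : D.comul P (y x) = y x ⊗ₜ 1 + 1 ⊗ₜ y x := by
  simp [comul, comulHom_gen, act_one]

/-- The algebra map `a ↦ (S(b) ↦ S(a b))`. -/
def antipodeHom : R →ₐ[k] Module.End k R :=
  P.lift (fun x => -(LinearMap.mulRight k (y x) ∘ₗ D.act P (D.deg x))) fun q hq => by
    obtain ⟨h, hh⟩ := D.deg_rel q hq
    ext a
    -- Applying two generators reverses them and twists one by the braiding; since the braiding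
    -- permutes the pairs of `q`, the result is again the relation, up to sign and a common left
    -- factor.
    have h1 := P.sum_map_eq_zero (-LinearMap.mulLeft k (D.act P h a)) hq
    rw [← D.braid_rel q hq, Multiset.map_map] at h1
    have h5 := map_multiset_sum (LinearMap.applyₗ (R := k) (M₂ := R) a)
    refine ((h5 _).trans ?_).trans h1
    rw [Multiset.map_map]
    refine congrArg _ (Multiset.map_congr rfl fun p hp => ?_)
    simp [← hh p hp, act_mul, mul_assoc, act_deg_gen]

theorem antipodeHom_gen (x : X) (a : R) :
    D.antipodeHom P (y x) a = -(D.act P (D.deg x) a * y x) := by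
  simp [antipodeHom]

/-- The antipode. -/
def antipode : R →ₗ[k] R :=
  LinearMap.applyₗ (R := k) (M₂ := R) 1 ∘ₗ (D.antipodeHom P).toLinearMap

theorem antipode_one : D.antipode P 1 = 1 := by
  simp [antipode]

theorem antipode_gen_mul (x : X) (a : R) :
    D.antipode P (y x * a) = -(D.act P (D.deg x) (D.antipode P a) * y x) := by
  simp [antipode, antipodeHom_gen]

theorem comul_gen_mul (x : X) (a : R) :
    D.comul P (y x * a) = D.comulHom P (y x) (D.comul P a) := comul_mul_eq ..

theorem coact_gen_mul (x : X) (a : R) : D.coact P (y x * a) =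
    (MonoidAlgebra.of k Γ (D.deg x) ⊗ₜ y x) * D.coact P a := by
  rw [map_mul, coact_gen]

theorem conj_mul (h : Γ) (a b : MonoidAlgebra k Γ) :
    conj k Γ h (a * b) = conj k Γ h a * conj k Γ h b := by
  have : MonoidAlgebra.of k Γ h⁻¹ * MonoidAlgebra.of k Γ h = 1 := by
    rw [← map_mul, inv_mul_cancel, map_one]
  simp only [conj, LinearMap.comp_apply, LinearMap.mulLeft_apply, LinearMap.mulRight_apply]
  calc _ = MonoidAlgebra.of k Γ h * (a * 1 * b * MonoidAlgebra.of k Γ h⁻¹) := by rw [mul_one]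
    _ = _ := by rw [← this]; simp only [mul_assoc]

theorem conj_of (h g : Γ) :
    conj k Γ h (MonoidAlgebra.of k Γ g) = MonoidAlgebra.of k Γ (h * g * h⁻¹) := by
  simp [conj, mul_assoc]

theorem coact_act (h : Γ) : (D.coact P).toLinearMap ∘ₗ D.act P h =
    TensorProduct.map (conj k Γ h) (D.act P h) ∘ₗ (D.coact P).toLinearMap := by
  refine P.linearMap_ext ?_ fun x a ha => ?_
  · have := conj_of (k := k) h 1
    simp only [map_one, mul_one, mul_inv_cancel] at this
    simp [act_one, Algebra.TensorProduct.one_def, this]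
  · simp only [LinearMap.comp_apply, AlgHom.toLinearMap_apply] at ha ⊢
    rw [act_mul, map_mul, ha, coact_gen_mul, act_gen, map_smul, coact_gen, deg_perm]
    induction D.coact P a with
    | zero => simp
    | add u v hu hv => rw [map_add, mul_add, mul_add, map_add, hu, hv]
    | tmul c b =>
      rw [Algebra.TensorProduct.tmul_mul_tmul, TensorProduct.map_tmul, TensorProduct.map_tmul,
        conj_mul, conj_of, act_mul, act_gen, ← TensorProduct.tmul_smul,
        Algebra.TensorProduct.tmul_mul_tmul]

/-- `a` is homogeneous of degree `g` for the coaction. -/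
def IsHomogeneous (g : Γ) (a : R) : Prop := D.coact P a = MonoidAlgebra.of k Γ g ⊗ₜ a

variable {D P}

theorem IsHomogeneous.mul {g h : Γ} {a b : R} (ha : D.IsHomogeneous P g a)
    (hb : D.IsHomogeneous P h b) : D.IsHomogeneous P (g * h) (a * b) := by
  rw [IsHomogeneous] at *
  rw [map_mul, ha, hb, Algebra.TensorProduct.tmul_mul_tmul, map_mul]

theorem IsHomogeneous.act {g : Γ} {a : R} (ha : D.IsHomogeneous P g a) (h : Γ) :
    D.IsHomogeneous P (h * g * h⁻¹) (D.act P h a) := by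
  rw [IsHomogeneous] at *
  have := LinearMap.congr_fun (D.coact_act P h) a
  simp only [LinearMap.comp_apply, AlgHom.toLinearMap_apply] at this
  rw [this, ha, TensorProduct.map_tmul, conj_of]

variable (D P)

theorem isHomogeneous_one : D.IsHomogeneous P 1 (1 : R) := by
  rw [IsHomogeneous, map_one, map_one]
  rfl

theorem isHomogeneous_gen (x : X) : D.IsHomogeneous P (D.deg x) (y x) := D.coact_gen P x

-- Allows a property to be carried along with the degree: colinearity is then checked on a spanning
-- set of homogeneous elements already known to have it.
include P in
theorem span_eq_top_of_left_stable {Q : Γ → R → Prop} (h1 : Q 1 1)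
    (hQ : ∀ x g a, Q g a → Q (D.deg x * g) (y x * a)) :
    Submodule.span k {a | ∃ g, Q g a} = ⊤ := by
  refine P.eq_top_of_left_stable (Submodule.subset_span ⟨1, h1⟩) ?_
  intro x a ha
  induction ha using Submodule.span_induction with
  | mem a ha =>
    obtain ⟨g, hg⟩ := ha
    exact Submodule.subset_span ⟨_, hQ x g a hg⟩
  | zero => simp
  | add a b _ _ ha hb => rw [mul_add]; exact add_mem ha hb
  | smul c a _ ha => rw [mul_smul_comm]; exact Submodule.smul_mem _ _ ha

theorem span_isHomogeneous : Submodule.span k {a | ∃ g, D.IsHomogeneous P g a} = ⊤ :=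
  D.span_eq_top_of_left_stable P (D.isHomogeneous_one P)
    fun x _ _ ha => (D.isHomogeneous_gen P x).mul ha

theorem linearMap_ext_isHomogeneous {M : Type*} [AddCommGroup M] [Module k M] {f f' : R →ₗ[k] M}
    (h : ∀ g a, D.IsHomogeneous P g a → f a = f' a) : f = f' :=
  LinearMap.ext_on (D.span_isHomogeneous P) fun a ⟨g, hg⟩ => h g a hg

theorem linearMap_ext_isHomogeneous₂ {M : Type*} [AddCommGroup M] [Module k M]
    {f f' : R ⊗[k] R →ₗ[k] M}
    (h : ∀ g g' a b, D.IsHomogeneous P g a → D.IsHomogeneous P g' b →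
      f (a ⊗ₜ b) = f' (a ⊗ₜ b)) : f = f' := by
  apply TensorProduct.ext
  refine D.linearMap_ext_isHomogeneous P fun g a ha => ?_
  exact D.linearMap_ext_isHomogeneous P fun g' b hb => h g g' a b ha hb

/-- The action and coaction on the presented algebra. -/
def ydData : YDData k Γ R where
  act := D.act P
  coact := (D.coact P).toLinearMap

/-- The Yetter-Drinfeld module structure on the presented algebra. -/
def ydModule : YDModule k Γ R where
  toYDData := D.ydData P
  coact_coassoc := by
    refine D.linearMap_ext_isHomogeneous P fun g a ha => ?_
    rw [IsHomogeneous] at ha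
    simp [ydData, ha]
  coact_counit := by
    refine D.linearMap_ext_isHomogeneous P fun g a ha => ?_
    rw [IsHomogeneous] at ha
    simp [ydData, ha]
  coact_act := D.coact_act P

end BraidedQuadraticDatum

end Construction

/-! ### The axioms of a braided Hopf algebra -/

section Construction

variable {k : Type u} [Field k] {Γ : Type} [Group Γ] {X : Type*} {R : Type u} [Ring R]
  [Algebra k R] {rels : Set (Multiset (X × X))} {y : X → R}

namespace BraidedQuadraticDatum

variable (D : BraidedQuadraticDatum k Γ rels) (P : IsQuadraticPresentation k rels y)

theorem map_act_comulHom (h : Γ) (x : X) (z : R ⊗[k] R) :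
    TensorProduct.map (D.act P h) (D.act P h) (D.comulHom P (y x) z) =
      D.χ h • D.comulHom P (y (D.perm h x)) (TensorProduct.map (D.act P h) (D.act P h) z) := by
  induction z with
  | zero => simp
  | add u v hu hv => simp only [map_add, hu, hv, smul_add]
  | tmul a b =>
    simp only [comulHom_gen, map_add, TensorProduct.map_tmul, act_mul, act_gen, act_act, deg_perm,
      inv_mul_cancel_right, smul_add, smul_mul_assoc, TensorProduct.smul_tmul',
      TensorProduct.tmul_smul]

theorem comul_act (h : Γ) : D.comul P ∘ₗ D.act P h =
    TensorProduct.map (D.act P h) (D.act P h) ∘ₗ D.comul P := by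
  refine P.linearMap_ext (by simp [act_one, comul_one]) fun x a ha => ?_
  simp only [LinearMap.comp_apply] at ha ⊢
  rw [act_mul, act_gen, comul_gen_mul, map_act_comulHom, smul_mul_assoc, map_smul, comul_gen_mul,
    ha]

theorem tensor_coact_tmul {g h : Γ} {a b : R} (ha : D.IsHomogeneous P g a)
    (hb : D.IsHomogeneous P h b) : ((D.ydData P).tensor (D.ydData P)).coact (a ⊗ₜ b) =
      MonoidAlgebra.of k Γ (g * h) ⊗ₜ (a ⊗ₜ b) := by
  rw [IsHomogeneous] at ha hb
  simp [ydData, YDData.tensor, ha, hb]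

/-- The operator of `y_x` multiplies degrees by `deg x` on the left; in its second term this is `(d
g d⁻¹)(d h) = d g h` with `d = deg x`. -/
theorem tensor_coact_comulHom (x : X) :
    ((D.ydData P).tensor (D.ydData P)).coact ∘ₗ D.comulHom P (y x) =
      TensorProduct.map (LinearMap.mulLeft k (MonoidAlgebra.of k Γ (D.deg x)))
        (D.comulHom P (y x)) ∘ₗ ((D.ydData P).tensor (D.ydData P)).coact := by
  refine D.linearMap_ext_isHomogeneous₂ P fun g h a b ha hb => ?_
  have hx := D.isHomogeneous_gen P x
  rw [LinearMap.comp_apply, LinearMap.comp_apply, tensor_coact_tmul D P ha hb, comulHom_gen,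
    map_add, tensor_coact_tmul D P (hx.mul ha) hb, tensor_coact_tmul D P (ha.act _) (hx.mul hb),
    TensorProduct.map_tmul, comulHom_gen, LinearMap.mulLeft_apply, ← map_mul,
    TensorProduct.tmul_add]
  simp only [mul_assoc, inv_mul_cancel_left]

theorem comul_coact : ((D.ydData P).tensor (D.ydData P)).coact ∘ₗ D.comul P =
    (D.comul P).lTensor (MonoidAlgebra k Γ) ∘ₗ (D.coact P).toLinearMap := by
  refine LinearMap.ext_on (D.span_eq_top_of_left_stable P
    (Q := fun g a => D.IsHomogeneous P g a ∧
      ((D.ydData P).tensor (D.ydData P)).coact (D.comul P a) =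
        MonoidAlgebra.of k Γ g ⊗ₜ D.comul P a) ?_ ?_) ?_
  · refine ⟨D.isHomogeneous_one P, ?_⟩
    rw [comul_one, tensor_coact_tmul D P (D.isHomogeneous_one P) (D.isHomogeneous_one P), mul_one]
  · rintro x g a ⟨ha, ha'⟩
    refine ⟨(D.isHomogeneous_gen P x).mul ha, ?_⟩
    have := LinearMap.congr_fun (D.tensor_coact_comulHom P x) (D.comul P a)
    rw [LinearMap.comp_apply, LinearMap.comp_apply, ha', TensorProduct.map_tmul,
      LinearMap.mulLeft_apply, ← map_mul] at this
    rw [comul_gen_mul, this]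
  · rintro a ⟨g, ha, ha'⟩
    rw [IsHomogeneous] at ha
    simp only [LinearMap.comp_apply, AlgHom.toLinearMap_apply, ha', ha, LinearMap.lTensor_tmul]

theorem braidedMul_tmul {h : Γ} {b : R} (hb : D.IsHomogeneous P h b) (a c d : R) :
    (D.ydData P).braidedMul ((a ⊗ₜ b) ⊗ₜ (c ⊗ₜ d)) = (a * D.act P h c) ⊗ₜ (b * d) := by
  rw [IsHomogeneous] at hb
  simp [YDData.braidedMul, YDData.braiding, YDData.actMap, ydData, hb]

theorem comulHom_braidedMul (x : X) (w z : R ⊗[k] R) :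
    D.comulHom P (y x) ((D.ydData P).braidedMul (w ⊗ₜ z)) =
      (D.ydData P).braidedMul (D.comulHom P (y x) w ⊗ₜ z) := by
  induction z with
  | zero => simp
  | add u v hu hv => simp only [TensorProduct.tmul_add, map_add, hu, hv]
  | tmul e f =>
    suffices D.comulHom P (y x) ∘ₗ (D.ydData P).braidedMul ∘ₗ
        (TensorProduct.mk k (R ⊗[k] R) (R ⊗[k] R)).flip (e ⊗ₜ f) =
      (D.ydData P).braidedMul ∘ₗ (TensorProduct.mk k (R ⊗[k] R) (R ⊗[k] R)).flip (e ⊗ₜ f) ∘ₗ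
        D.comulHom P (y x) from LinearMap.congr_fun this w
    refine D.linearMap_ext_isHomogeneous₂ P fun g h a b ha hb => ?_
    simp only [LinearMap.comp_apply, LinearMap.flip_apply, TensorProduct.mk_apply, comulHom_gen,
      map_add, braidedMul_tmul D P hb,
      braidedMul_tmul D P ((D.isHomogeneous_gen P x).mul hb), act_mul, act_act, mul_assoc]

/-- Identifies the operators with left multiplication in the braided tensor product, which turns
`comul_mul_eq` into the compatibility of `Δ` with the product. The only associativity needed is that
for one generator, `comulHom_braidedMul`. -/
theorem comulHom_eq_braidedMul (a : R) (z : R ⊗[k] R) :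
    D.comulHom P a z = (D.ydData P).braidedMul (D.comul P a ⊗ₜ z) := by
  suffices (D.comulHom P).toLinearMap =
      TensorProduct.curry (D.ydData P).braidedMul ∘ₗ D.comul P from
    LinearMap.congr_fun (LinearMap.congr_fun this a) z
  refine P.linearMap_ext ?_ fun x a ha => ?_
  · ext a b
    simp [comul_one, braidedMul_tmul D P (D.isHomogeneous_one P)]
  · ext1
    ext1 b
    ext1 c
    have := LinearMap.congr_fun ha (b ⊗ₜ c)
    simp only [AlgHom.toLinearMap_apply, LinearMap.comp_apply, TensorProduct.curry_apply] at this
    simp [comul_gen_mul, ← comulHom_braidedMul, this]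

theorem coassoc : (TensorProduct.assoc k R R R).toLinearMap ∘ₗ (D.comul P).rTensor R ∘ₗ D.comul P =
    (D.comul P).lTensor R ∘ₗ D.comul P := by
  refine P.linearMap_ext (by simp [comul_one]) fun x a ha => ?_
  -- `Θ` is the operator of `y_x` on the threefold braided tensor product; both iterated coproducts
  -- intertwine with it.
  set Θ : R ⊗[k] (R ⊗[k] R) →ₗ[k] R ⊗[k] (R ⊗[k] R) :=
    TensorProduct.map (LinearMap.mulLeft k (y x)) LinearMap.id +
      TensorProduct.map (D.act P (D.deg x)) (D.comulHom P (y x)) with hΘ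
  have hl : (D.comul P).lTensor R ∘ₗ D.comulHom P (y x) = Θ ∘ₗ (D.comul P).lTensor R := by
    ext a b
    simp [comulHom_gen, comul_gen_mul, hΘ]
  have hr : (TensorProduct.assoc k R R R).toLinearMap ∘ₗ (D.comul P).rTensor R ∘ₗ
      D.comulHom P (y x) = Θ ∘ₗ (TensorProduct.assoc k R R R).toLinearMap ∘ₗ
        (D.comul P).rTensor R := by
    ext a b
    have := LinearMap.congr_fun (D.comul_act P (D.deg x)) a
    simp only [LinearMap.comp_apply] at this
    simp only [TensorProduct.AlgebraTensorModule.curry_apply, LinearMap.restrictScalars_self,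
      TensorProduct.curry_apply, LinearMap.comp_apply, LinearEquiv.coe_coe, comulHom_gen, map_add,
      LinearMap.rTensor_tmul, comul_gen_mul, this]
    induction D.comul P a with
    | zero => simp
    | add u v hu hv =>
      simp only [map_add, TensorProduct.add_tmul, ← hu, ← hv]
      abel
    | tmul c d =>
      simp [hΘ, comulHom_gen, TensorProduct.add_tmul, TensorProduct.tmul_add, add_assoc]
  have hl' := LinearMap.congr_fun hl (D.comul P a)
  have hr' := LinearMap.congr_fun hr (D.comul P a)
  simp only [LinearMap.comp_apply] at hl' hr' ha ⊢
  rw [comul_gen_mul, hl', hr', ha]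

theorem rTensor_counit_comul : P.counit.toLinearMap.rTensor R ∘ₗ D.comul P =
    TensorProduct.mk k k R 1 := by
  refine P.linearMap_ext (by simp [comul_one]) fun x a ha => ?_
  have h : P.counit.toLinearMap.rTensor R ∘ₗ D.comulHom P (y x) =
      (LinearMap.mulLeft k (y x)).lTensor k ∘ₗ P.counit.toLinearMap.rTensor R := by
    ext a b
    simp [comulHom_gen, counit_act]
  have := LinearMap.congr_fun h (D.comul P a)
  simp only [LinearMap.comp_apply] at this ha ⊢
  rw [comul_gen_mul, this, ha]
  simp

theorem lTensor_counit_comul : P.counit.toLinearMap.lTensor R ∘ₗ D.comul P =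
    (TensorProduct.mk k R k).flip 1 := by
  refine P.linearMap_ext (by simp [comul_one]) fun x a ha => ?_
  have h : P.counit.toLinearMap.lTensor R ∘ₗ D.comulHom P (y x) =
      (LinearMap.mulLeft k (y x)).rTensor k ∘ₗ P.counit.toLinearMap.lTensor R := by
    ext a b
    simp [comulHom_gen]
  have := LinearMap.congr_fun h (D.comul P a)
  simp only [LinearMap.comp_apply] at this ha ⊢
  rw [comul_gen_mul, this, ha]
  simp

theorem antipode_act (h : Γ) : D.antipode P ∘ₗ D.act P h = D.act P h ∘ₗ D.antipode P := by
  refine P.linearMap_ext (by simp [act_one, antipode_one]) fun x a ha => ?_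
  simp only [LinearMap.comp_apply] at ha ⊢
  rw [act_mul, act_gen, smul_mul_assoc, map_smul, antipode_gen_mul, ha, antipode_gen_mul, map_neg,
    act_mul, act_gen, act_act, act_act, deg_perm, inv_mul_cancel_right, mul_smul_comm, smul_neg]

theorem antipode_coact : (D.coact P).toLinearMap ∘ₗ D.antipode P =
    (D.antipode P).lTensor (MonoidAlgebra k Γ) ∘ₗ (D.coact P).toLinearMap := by
  refine LinearMap.ext_on (D.span_eq_top_of_left_stable P
    (Q := fun g a => D.IsHomogeneous P g a ∧ D.IsHomogeneous P g (D.antipode P a)) ?_ ?_) ?_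
  · rw [antipode_one]
    exact ⟨D.isHomogeneous_one P, D.isHomogeneous_one P⟩
  · rintro x g a ⟨ha, ha'⟩
    have hx := D.isHomogeneous_gen P x
    refine ⟨hx.mul ha, ?_⟩
    have := (ha'.act (D.deg x)).mul hx
    rw [inv_mul_cancel_right, IsHomogeneous] at this
    rw [antipode_gen_mul, IsHomogeneous, map_neg, this, TensorProduct.tmul_neg]
  · rintro a ⟨g, ha, ha'⟩
    rw [IsHomogeneous] at ha ha'
    simp only [LinearMap.comp_apply, AlgHom.toLinearMap_apply, ha', ha, LinearMap.lTensor_tmul]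

theorem antipode_left : LinearMap.mul' k R ∘ₗ (D.antipode P).rTensor R ∘ₗ D.comul P =
    Algebra.linearMap k R ∘ₗ P.counit.toLinearMap := by
  refine P.linearMap_ext (by simp [comul_one, antipode_one]) fun x a _ => ?_
  -- With `g = deg x`, the two terms are `-(g S(a)) y_x b` and `S(g a) y_x b`; they cancel without
  -- the induction hypothesis.
  have h : LinearMap.mul' k R ∘ₗ (D.antipode P).rTensor R ∘ₗ D.comulHom P (y x) = 0 := by
    ext a b
    have := LinearMap.congr_fun (D.antipode_act P (D.deg x)) a
    simp only [LinearMap.comp_apply] at this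
    simp [comulHom_gen, antipode_gen_mul, this, mul_assoc]
  have := LinearMap.congr_fun h (D.comul P a)
  simp only [LinearMap.comp_apply] at this ⊢
  rw [comul_gen_mul, this]
  simp

theorem antipode_right : LinearMap.mul' k R ∘ₗ (D.antipode P).lTensor R ∘ₗ D.comul P =
    Algebra.linearMap k R ∘ₗ P.counit.toLinearMap := by
  refine P.linearMap_ext (by simp [comul_one, antipode_one]) fun x a ha => ?_
  -- Here one gets `y_x m - (g m) y_x` with `m = a S(b)`. It vanishes once the induction hypothesis
  -- makes the total `m` a scalar.
  have h : LinearMap.mul' k R ∘ₗ (D.antipode P).lTensor R ∘ₗ D.comulHom P (y x) =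
      (LinearMap.mulLeft k (y x) - LinearMap.mulRight k (y x) ∘ₗ D.act P (D.deg x)) ∘ₗ
        LinearMap.mul' k R ∘ₗ (D.antipode P).lTensor R := by
    ext a b
    simp [comulHom_gen, antipode_gen_mul, act_mul, mul_assoc, sub_eq_add_neg]
  have := LinearMap.congr_fun h (D.comul P a)
  simp only [LinearMap.comp_apply] at this ha ⊢
  rw [comul_gen_mul, this, ha]
  simp [Algebra.algebraMap_eq_smul_one, act_one]

/-- The braided Hopf algebra structure on the presented algebra in which the generators are
primitive. -/
def hopf : YDHopfAlgebra k Γ R where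
  toYDModule := D.ydModule P
  comul := D.comul P
  counit := P.counit.toLinearMap
  coassoc := D.coassoc P
  rTensor_counit_comp_comul := D.rTensor_counit_comul P
  lTensor_counit_comp_comul := D.lTensor_counit_comul P
  antipode := D.antipode P
  mul_hom := by
    refine ⟨fun g => ?_, ?_⟩
    · ext a b
      exact (D.act_mul P g a b).symm
    · refine D.linearMap_ext_isHomogeneous₂ P fun g h a b ha hb => ?_
      have h1 := D.tensor_coact_tmul P ha hb
      have h2 := ha.mul hb
      rw [IsHomogeneous] at h2
      change D.coact P (a * b) = (LinearMap.mul' k R).lTensor _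
        (((D.ydData P).tensor (D.ydData P)).coact (a ⊗ₜ b))
      rw [h1, h2]
      simp
  unit_hom := by
    refine ⟨fun g => ?_, ?_⟩
    · ext
      simp [YDData.unit, ydModule, ydData, act_one]
    · ext
      simp [YDData.unit, ydModule, ydData, Algebra.TensorProduct.one_def]
  comul_hom := ⟨D.comul_act P, D.comul_coact P⟩
  counit_hom := by
    refine ⟨fun g => LinearMap.ext fun a => ?_, ?_⟩
    · exact D.counit_act P g a
    · refine P.linearMap_ext ?_ fun x a _ => ?_
      · simp [YDData.unit, ydModule, ydData, Algebra.TensorProduct.one_def]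
      · have : (P.counit.toLinearMap.lTensor (MonoidAlgebra k Γ)) ∘ₗ LinearMap.mulLeft k
            (MonoidAlgebra.of k Γ (D.deg x) ⊗ₜ[k] y x) = 0 := by
          ext
          simp
        have := LinearMap.congr_fun this (D.coact P a)
        simp only [LinearMap.comp_apply, LinearMap.mulLeft_apply] at this
        simp only [YDData.unit, ydModule, ydData, LinearMap.comp_apply, AlgHom.toLinearMap_apply,
          coact_gen_mul, this]
        simp
  antipode_hom := ⟨D.antipode_act P, D.antipode_coact P⟩
  counit_one := map_one P.counit
  counit_mul := map_mul P.counit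
  comul_one := D.comul_one P
  comul_mul := by
    ext a b
    change D.comul P (a * b) = (D.ydData P).braidedMul (D.comul P a ⊗ₜ D.comul P b)
    rw [comul_mul_eq, comulHom_eq_braidedMul]
  antipode_left := D.antipode_left P
  antipode_right := D.antipode_right P

end BraidedQuadraticDatum

end Construction

/-! ### Grading, primitive elements, skew derivations and naturality -/

section Grading

variable {k : Type u} [Field k] {Γ : Type} [Group Γ] {X : Type*} {R : Type u} [Ring R]
  [Algebra k R] {rels : Set (Multiset (X × X))} {y : X → R}

theorem span_pow_le {N : ℕ → Submodule k R} (h0 : 1 ∈ N 0)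
    (hN : ∀ d x, ∀ a ∈ N d, y x * a ∈ N (d + 1)) (d : ℕ) :
    Submodule.span k (Set.range y) ^ d ≤ N d := by
  induction d with
  | zero => rwa [pow_zero, Submodule.one_le]
  | succ d ih =>
    rw [pow_succ', Submodule.mul_le]
    intro v hv a ha
    induction hv using Submodule.span_induction with
    | mem v hv =>
      obtain ⟨x, rfl⟩ := hv
      exact hN d x a (ih ha)
    | zero => simp
    | add v w _ _ hv hw => rw [add_mul]; exact add_mem hv hw
    | smul c v _ hv => rw [smul_mul_assoc]; exact Submodule.smul_mem _ _ hv

theorem gen_mul_mem_span_pow (x : X) {d : ℕ} {a : R}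
    (ha : a ∈ Submodule.span k (Set.range y) ^ d) :
    y x * a ∈ Submodule.span k (Set.range y) ^ (d + 1) := by
  rw [pow_succ']
  exact Submodule.mul_mem_mul (Submodule.subset_span ⟨x, rfl⟩) ha

theorem iSup_pow_sq (N : Submodule k R) :
    (⨆ i, ⨆ _ : 1 ≤ i, N ^ i) ^ 2 = ⨆ i, ⨆ _ : 2 ≤ i, N ^ i := by
  apply le_antisymm
  · simp only [pow_two, Submodule.iSup_mul, Submodule.mul_iSup, iSup_le_iff, ← pow_add]
    exact fun i hi j hj => le_iSup₂_of_le (f := fun i (_ : 2 ≤ i) => N ^ i) (j + i) (by lia) le_rfl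
  · refine iSup₂_le fun i hi => ?_
    obtain ⟨j, rfl⟩ := Nat.exists_eq_add_of_le' hi
    rw [pow_two, show j + 2 = 1 + (j + 1) by ring, pow_add]
    exact mul_le_mul' (le_iSup₂_of_le (f := fun i (_ : 1 ≤ i) => N ^ i) 1 le_rfl le_rfl)
      (le_iSup₂_of_le (f := fun i (_ : 1 ≤ i) => N ^ i) (j + 1) (by lia) le_rfl)

namespace BraidedQuadraticDatum

variable (D : BraidedQuadraticDatum k Γ rels) (P : IsQuadraticPresentation k rels y)

theorem act_mem_span_pow (g : Γ) {d : ℕ} {a : R}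
    (ha : a ∈ Submodule.span k (Set.range y) ^ d) :
    D.act P g a ∈ Submodule.span k (Set.range y) ^ d := by
  refine span_pow_le (N := fun d => (Submodule.span k (Set.range y) ^ d).comap (D.act P g))
    ?_ (fun d x a ha => ?_) d ha
  · rw [Submodule.mem_comap, act_one]
    exact Submodule.one_le.1 (pow_zero _).ge
  · rw [Submodule.mem_comap] at ha ⊢
    rw [act_mul, act_gen, smul_mul_assoc]
    exact Submodule.smul_mem _ _ (gen_mul_mem_span_pow _ ha)

theorem coact_mem_span_pow {d : ℕ} {a : R} (ha : a ∈ Submodule.span k (Set.range y) ^ d) :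
    D.coact P a ∈ LinearMap.range
      ((Submodule.span k (Set.range y) ^ d).subtype.lTensor (MonoidAlgebra k Γ)) := by
  refine span_pow_le (N := fun d => (LinearMap.range
      ((Submodule.span k (Set.range y) ^ d).subtype.lTensor (MonoidAlgebra k Γ))).comap
      (D.coact P).toLinearMap) ?_ (fun d x a ha => ?_) d ha
  · exact ⟨1 ⊗ₜ ⟨1, Submodule.one_le.1 (pow_zero _).ge⟩, by simp [Algebra.TensorProduct.one_def]⟩
  · rw [Submodule.mem_comap, AlgHom.toLinearMap_apply] at ha ⊢
    rw [coact_gen_mul]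
    obtain ⟨z, hz⟩ := ha
    rw [← hz]
    clear hz
    induction z with
    | zero => simp
    | add u v hu hv => rw [map_add, mul_add]; exact add_mem hu hv
    | tmul c b =>
      exact ⟨(MonoidAlgebra.of k Γ (D.deg x) * c) ⊗ₜ ⟨y x * b, gen_mul_mem_span_pow x b.2⟩, by simp⟩

theorem comul_mem_span_pow {d : ℕ} {a : R} (ha : a ∈ Submodule.span k (Set.range y) ^ d) :
    D.comul P a ∈ ⨆ ij ∈ Finset.HasAntidiagonal.antidiagonal d, LinearMap.range
      (TensorProduct.mapIncl (Submodule.span k (Set.range y) ^ ij.1)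
        (Submodule.span k (Set.range y) ^ ij.2)) := by
  have key : ∀ {i j d : ℕ} {a b : R}, i + j = d → a ∈ Submodule.span k (Set.range y) ^ i →
      b ∈ Submodule.span k (Set.range y) ^ j → a ⊗ₜ[k] b ∈
      ⨆ ij ∈ Finset.HasAntidiagonal.antidiagonal d, LinearMap.range
      (TensorProduct.mapIncl (Submodule.span k (Set.range y) ^ ij.1)
        (Submodule.span k (Set.range y) ^ ij.2)) := by
    intro i j d a b hij ha hb
    exact Submodule.mem_iSup_of_mem (i, j) (Submodule.mem_iSup_of_mem
      (Finset.HasAntidiagonal.mem_antidiagonal.2 hij) ⟨⟨a, ha⟩ ⊗ₜ ⟨b, hb⟩, rfl⟩)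
  refine span_pow_le (N := fun d => (⨆ ij ∈ Finset.HasAntidiagonal.antidiagonal d, LinearMap.range
      (TensorProduct.mapIncl (Submodule.span k (Set.range y) ^ ij.1)
        (Submodule.span k (Set.range y) ^ ij.2))).comap (D.comul P)) ?_ (fun d x a ha => ?_) d ha
  · rw [Submodule.mem_comap, comul_one]
    exact key (add_zero 0) (Submodule.one_le.1 (pow_zero _).ge) (Submodule.one_le.1 (pow_zero _).ge)
  · rw [Submodule.mem_comap] at ha ⊢
    rw [comul_gen_mul]
    rw [← Submodule.mem_comap]
    refine iSup₂_le (a := Submodule.comap (D.comulHom P (y x)) _) ?_ ha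
    rintro ⟨i, j⟩ hij _ ⟨z, rfl⟩
    rw [Finset.HasAntidiagonal.mem_antidiagonal] at hij
    induction z with
    | zero => simp
    | add u v hu hv => rw [map_add]; exact add_mem hu hv
    | tmul a b =>
      rw [Submodule.mem_comap, TensorProduct.mapIncl, TensorProduct.map_tmul, comulHom_gen]
      dsimp only at hij
      exact add_mem
        (key (i := i + 1) (j := j) (by lia) (gen_mul_mem_span_pow x a.2) b.2)
        (key (i := i) (j := j + 1) (by lia) (D.act_mem_span_pow P _ a.2)
          (gen_mul_mem_span_pow x b.2))

theorem isGradedHopf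
    (h : DirectSum.IsInternal fun d : ℕ => Submodule.span k (Set.range y) ^ d) :
    IsGradedHopf (D.hopf P) fun d => Submodule.span k (Set.range y) ^ d where
  isInternal := h
  act_mem _ g _ ha := D.act_mem_span_pow P g ha
  coact_mem _ _ ha := D.coact_mem_span_pow P ha
  mul_le i j := (pow_add _ i j).ge
  comul_mem _ _ ha := D.comul_mem_span_pow P ha

theorem gen_mem_primitives (x : X) : y x ∈ (D.hopf P).primitives :=
  (D.comul_gen P x).trans (add_comm _ _)

/-- The skew derivation `(id ⊗ f) Δ`. -/
def skewDer (f : R →ₗ[k] k) : R →ₗ[k] R :=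
  (TensorProduct.rid k R).toLinearMap ∘ₗ f.lTensor R ∘ₗ D.comul P

theorem skewDer_one (f : R →ₗ[k] k) (h1 : f 1 = 0) : D.skewDer P f 1 = 0 := by
  simp [skewDer, comul_one, h1]

/-- A twisted Leibniz rule. The hypothesis on `f` means that it sees only the linear part of an
element beginning with a generator, so in the second term only `(id ⊗ ε) Δ(a) = a` remains. -/
theorem skewDer_gen_mul {f : R →ₗ[k] k}
    (hf : ∀ x a, f (y x * a) = f (y x) * P.counit a) (x : X) (a : R) :
    D.skewDer P f (y x * a) = y x * D.skewDer P f a + f (y x) • D.act P (D.deg x) a := by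
  have h : (TensorProduct.rid k R).toLinearMap ∘ₗ f.lTensor R ∘ₗ D.comulHom P (y x) =
      LinearMap.mulLeft k (y x) ∘ₗ (TensorProduct.rid k R).toLinearMap ∘ₗ f.lTensor R +
        f (y x) • (D.act P (D.deg x) ∘ₗ (TensorProduct.rid k R).toLinearMap ∘ₗ
          P.counit.toLinearMap.lTensor R) := by
    ext a b
    simp [comulHom_gen, hf, smul_smul]
  have h1 := LinearMap.congr_fun h (D.comul P a)
  have h2 := LinearMap.congr_fun (D.lTensor_counit_comul P) a
  simp only [LinearMap.comp_apply, LinearMap.add_apply, LinearMap.smul_apply] at h1 h2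
  simp only [skewDer, LinearMap.comp_apply]
  rw [comul_gen_mul, h1, h2]
  simp

theorem skewDer_of_mem_primitives {f : R →ₗ[k] k} (h1 : f 1 = 0) {a : R}
    (ha : a ∈ (D.hopf P).primitives) : D.skewDer P f a = f a • 1 := by
  have ha : D.comul P a = 1 ⊗ₜ a + a ⊗ₜ 1 := ha
  simp [skewDer, ha, h1]

theorem counit_of_mem_primitives {a : R} (ha : a ∈ (D.hopf P).primitives) : P.counit a = 0 := by
  have ha : D.comul P a = 1 ⊗ₜ a + a ⊗ₜ 1 := ha
  have h := congrArg (TensorProduct.rid k R) (LinearMap.congr_fun (D.lTensor_counit_comul P) a)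
  simp [ha] at h
  -- Applying `id ⊗ ε` leaves `ε(a) · 1 = 0` in `R`; if `1 = 0` there, then `a = 0`.
  rcases h with h | h
  · exact h
  · rw [← mul_one a, h, mul_zero, map_zero]

section Naturality

variable {Γ' : Type} [Group Γ'] {R' : Type u} [Ring R'] [Algebra k R'] {y' : X → R'}
  {D P} {D' : BraidedQuadraticDatum k Γ' rels} {P' : IsQuadraticPresentation k rels y'}
  {φ : Γ →* Γ'} {F : R →ₐ[k] R'}

theorem map_act (hp : ∀ g x, D'.perm (φ g) x = D.perm g x) (hχ : ∀ g, D'.χ (φ g) = D.χ g)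
    (hF : ∀ x, F (y x) = y' x) (g : Γ) :
    F.toLinearMap ∘ₗ D.act P g = D'.act P' (φ g) ∘ₗ F.toLinearMap := by
  have : F.comp (D.actHom P g) = (D'.actHom P' (φ g)).comp F :=
    P.algHom_ext fun x => by simp [hF, hp, hχ]
  exact congrArg AlgHom.toLinearMap this

theorem isYDHomAlong (hd : ∀ x, D'.deg x = φ (D.deg x))
    (hp : ∀ g x, D'.perm (φ g) x = D.perm g x) (hχ : ∀ g, D'.χ (φ g) = D.χ g)
    (hF : ∀ x, F (y x) = y' x) :
    IsYDHomAlong φ (D.hopf P).toYDData (D'.hopf P').toYDData F.toLinearMap := by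
  refine ⟨map_act hp hχ hF, LinearMap.ext_on (D.span_eq_top_of_left_stable P
    (Q := fun g a => D.IsHomogeneous P g a ∧ D'.IsHomogeneous P' (φ g) (F a)) ?_ ?_) ?_⟩
  · rw [map_one, map_one]
    exact ⟨D.isHomogeneous_one P, D'.isHomogeneous_one P'⟩
  · rintro x g a ⟨ha, ha'⟩
    refine ⟨(D.isHomogeneous_gen P x).mul ha, ?_⟩
    rw [map_mul, map_mul, ← hd, hF]
    exact (D'.isHomogeneous_gen P' x).mul ha'
  · rintro a ⟨g, ha, ha'⟩
    rw [IsHomogeneous] at ha ha'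
    change D'.coact P' (F a) = TensorProduct.map _ _ (D.coact P a)
    rw [ha, ha']
    simp

theorem map_comul (hd : ∀ x, D'.deg x = φ (D.deg x))
    (hp : ∀ g x, D'.perm (φ g) x = D.perm g x) (hχ : ∀ g, D'.χ (φ g) = D.χ g)
    (hF : ∀ x, F (y x) = y' x) :
    D'.comul P' ∘ₗ F.toLinearMap =
      TensorProduct.map F.toLinearMap F.toLinearMap ∘ₗ D.comul P := by
  refine P.linearMap_ext (by simp [comul_one]) fun x a ha => ?_
  have h : D'.comulHom P' (y' x) ∘ₗ TensorProduct.map F.toLinearMap F.toLinearMap =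
      TensorProduct.map F.toLinearMap F.toLinearMap ∘ₗ D.comulHom P (y x) := by
    ext a b
    have := LinearMap.congr_fun (map_act (P := P) (P' := P') hp hχ hF (D.deg x)) a
    simp only [LinearMap.comp_apply, AlgHom.toLinearMap_apply] at this
    simp [comulHom_gen, hF, hd, this]
  have := LinearMap.congr_fun h (D.comul P a)
  simp only [LinearMap.comp_apply, AlgHom.toLinearMap_apply] at this ha ⊢
  rw [comul_gen_mul, ← this, ← ha, map_mul, hF, comul_gen_mul]

end Naturality

end BraidedQuadraticDatum

theorem IsQuadraticPresentation.counit_comp {R' : Type u} [Ring R'] [Algebra k R'] {y' : X → R'}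
    (P : IsQuadraticPresentation k rels y) (P' : IsQuadraticPresentation k rels y')
    {F : R →ₐ[k] R'} (hF : ∀ x, F (y x) = y' x) : P'.counit.comp F = P.counit :=
  P.algHom_ext fun x => by simp [hF]

end Grading

/-! ### Linear maps out of `M(g, ρ)` -/

section Induced

variable {k Γ : Type*} [Field k] [Group Γ] (g : Γ) {W N : Type*} [AddCommGroup W] [Module k W]
  [AddCommGroup N] [Module k N] (ρ : Representation k (Subgroup.centralizer ({g} : Set Γ)) W)

/-- Linear maps out of `M(g, ρ)`. -/
def MSpace.lift (f : Γ → W →ₗ[k] N)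
    (hf : ∀ x (c : Subgroup.centralizer ({g} : Set Γ)), f (x * c) = f x ∘ₗ ρ c) :
    MSpace g ρ →ₗ[k] N :=
  Representation.Coinvariants.lift _
    -- The inverse undoes the one in `MSpace.tmul`.
    (TensorProduct.lift ((Finsupp.lift _ _ _ fun x => f x⁻¹) ∘ₗ
      (MonoidAlgebra.coeffLinearEquiv k).toLinearMap)) fun c => by
    ext x w
    have := hf x⁻¹ c⁻¹
    simp only [Subgroup.coe_inv] at this
    simp [this]

@[simp]
theorem MSpace.lift_tmul (f : Γ → W →ₗ[k] N)
    (hf : ∀ x (c : Subgroup.centralizer ({g} : Set Γ)), f (x * c) = f x ∘ₗ ρ c) (x : Γ) (w : W) :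
    MSpace.lift g ρ f hf (MSpace.tmul g ρ x w) = f x w := by
  simp [MSpace.lift, MSpace.tmul]

theorem MSpace.tmul_mul (x : Γ) (c : Subgroup.centralizer ({g} : Set Γ)) (w : W) :
    MSpace.tmul g ρ (x * c) w = MSpace.tmul g ρ x (ρ c w) := by
  have := Representation.Coinvariants.mk_self_apply (Representation.tprod
    ((Representation.leftRegular k Γ).comp (Subgroup.centralizer ({g} : Set Γ)).subtype) ρ)
    c (MonoidAlgebra.single (x * c)⁻¹ 1 ⊗ₜ w)
  simp at this
  simp [MSpace.tmul, this]

end Induced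

/-! ### The common relations and the data over `D₃` and `S₃` -/

section FominKirillov

/-- The quadratic relations `y_i² = 0` and `∑ᵢ y_i y_{i+s} = 0` (`s ≠ 0`), with `i ∈ ℤ/3`. -/
def fkRels : Set (Multiset (ZMod 3 × ZMod 3)) :=
  {q | (∃ i, q = {(i, i)}) ∨
    ∃ s, s ≠ 0 ∧ q = (Finset.univ : Finset (ZMod 3)).val.map fun i => (i, i + s)}

theorem forall_mem_fkRels {p : Multiset (ZMod 3 × ZMod 3) → Prop} :
    (∀ q ∈ fkRels, p q) ↔ (∀ i, p {(i, i)}) ∧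
      ∀ s, s ≠ 0 → p ((Finset.univ : Finset (ZMod 3)).val.map fun i => (i, i + s)) := by
  constructor
  · exact fun h => ⟨fun i => h _ (.inl ⟨i, rfl⟩), fun s hs => h _ (.inr ⟨s, hs, rfl⟩)⟩
  · rintro ⟨h, h'⟩ q (⟨i, rfl⟩ | ⟨s, hs, rfl⟩)
    exacts [h i, h' s hs]

/-- The action of the dihedral group on the vertices of the triangle. -/
def dihedralPerm : DihedralGroup 3 → ZMod 3 → ZMod 3
  | .r a, i => a + i
  | .sr a, i => -(a + i)

variable (k : Type u) [Field k]

/-- The datum of `V = M(σ, χ)` over the dihedral group of order 6. -/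
def dihedralDatum : BraidedQuadraticDatum k (DihedralGroup 3) fkRels where
  deg := .sr
  perm := dihedralPerm
  χ := dihedralSign k 3
  perm_one := by decide
  perm_mul := by decide
  deg_perm := by decide
  χ_deg _ := rfl
  perm_rel g := by
    refine forall_mem_fkRels.2 ⟨fun i => .inl ⟨dihedralPerm g i, rfl⟩, fun s hs => .inr ?_⟩
    revert g s
    decide
  deg_rel := by
    refine forall_mem_fkRels.2 ⟨fun i => ⟨1, ?_⟩, fun s hs => ⟨.r s, ?_⟩⟩
    · revert i
      decide
    · revert s
      decide
  braid_rel := by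
    -- The braiding sends `(i, i + s)` to `(-(2i + s), i) = (i - s, i)`, a cyclic shift of the pairs
    -- of the relation.
    refine forall_mem_fkRels.2 ⟨?_, ?_⟩ <;> decide

/-- The transposition that fixes `i`. -/
def swapFixing (i : ZMod 3) : Equiv.Perm (Fin 3) := Equiv.swap (i + 1 : ZMod 3) (i + 2 : ZMod 3)

/-- The datum of `V'` over the symmetric group on three letters. -/
def symmetricDatum : BraidedQuadraticDatum k (Equiv.Perm (Fin 3)) fkRels where
  deg := swapFixing
  perm s i := s i
  χ := ((Int.castRingHom k : ℤ →* k).comp (Units.coeHom ℤ)).comp Equiv.Perm.sign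
  perm_one _ := rfl
  perm_mul _ _ _ := rfl
  deg_perm := by decide
  χ_deg i := by
    have : Equiv.Perm.sign (swapFixing i) = -1 := by
      revert i
      decide
    simp [this]
  perm_rel g := by
    refine forall_mem_fkRels.2 ⟨fun i => .inl ⟨g i, rfl⟩, fun s hs => .inr ?_⟩
    revert g s
    decide
  deg_rel := by
    refine forall_mem_fkRels.2 ⟨fun i => ⟨1, ?_⟩,
      fun s hs => ⟨swapFixing 0 * swapFixing s, ?_⟩⟩
    · revert i
      decide
    · revert s
      decide
  braid_rel := by
    refine forall_mem_fkRels.2 ⟨?_, ?_⟩ <;> decide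

theorem dihedralPerm_inv_left : ∀ g i, dihedralPerm g⁻¹ (dihedralPerm g i) = i := by decide

theorem dihedralPerm_inv_right : ∀ g i, dihedralPerm g (dihedralPerm g⁻¹ i) = i := by decide

/-- The isomorphism `D₃ ≃ S₃` given by the action on the vertices of the triangle. -/
def dihedralEquivPerm : DihedralGroup 3 ≃* Equiv.Perm (Fin 3) :=
  MulEquiv.ofBijective (MonoidHom.mk' (fun g => (⟨dihedralPerm g, dihedralPerm g⁻¹,
    dihedralPerm_inv_left g,
    dihedralPerm_inv_right g⟩ : Equiv.Perm (Fin 3))) (by decide)) (by decide)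

end FominKirillov

/-! ### The presentation of `R²₃` -/

section DihedralPresentation

variable (k : Type u) [Field k]

theorem v2_eq (i : ZMod 3) :
    v2 k 3 i = MSpace.tmul (sigma 3) (chi k 3) (.r i) 1 := by
  rw [v2]
  exact (MSpace.act_tmul _ _ _ _ _).trans (by rw [mul_one])

/-- Since `sr i = r (-i) * σ`, the factor `σ` moves across the tensor sign and acts by `-1`. -/
theorem tmul_sr (i : ZMod 3) (w : k) : MSpace.tmul (sigma 3) (chi k 3) (.sr i) w =
    MSpace.tmul (sigma 3) (chi k 3) (.r (-i)) (-w) := by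
  have h : sigma 3 ∈ Subgroup.centralizer ({sigma 3} : Set (DihedralGroup 3)) := by
    rw [Subgroup.mem_centralizer_iff]
    rintro _ rfl
    rfl
  have h1 := MSpace.tmul_mul (sigma 3) (chi k 3) (.r (-i)) ⟨sigma 3, h⟩ w
  have h2 : chi k 3 ⟨sigma 3, h⟩ w = -w := neg_one_mul w
  rw [h2] at h1
  simpa only [DihedralGroup.r_mul_sr, zero_sub, neg_neg] using h1

theorem act_v2 (g : DihedralGroup 3) (i : ZMod 3) :
    (V2 k 3).act g (v2 k 3 i) = dihedralSign k 3 g • v2 k 3 (dihedralPerm g i) := by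
  rw [v2_eq, v2_eq]
  refine (MSpace.act_tmul _ _ _ _ _).trans ?_
  rcases g with a | a
  · have h : dihedralSign k 3 (.r a) = 1 := rfl
    rw [h, one_smul]
    rfl
  · have h : dihedralSign k 3 (.sr a) = -1 := rfl
    rw [h, DihedralGroup.sr_mul_r, tmul_sr, neg_one_smul, MSpace.tmul, MSpace.tmul, map_neg]
    rfl

/-- The formula is forced by `x ⊗ 1 = sign(x) y_{x · 0}`; it is well defined because the centralizer
of `σ` fixes the vertex `0`. -/
theorem exists_linearMap_v2 {N : Type*} [AddCommGroup N] [Module k N] (f : ZMod 3 → N) :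
    ∃ F : MSpace (sigma 3) (chi k 3) →ₗ[k] N, ∀ i, F (v2 k 3 i) = f i := by
  refine ⟨MSpace.lift _ _ (fun x => LinearMap.toSpanSingleton k N
    (dihedralSign k 3 x • f (dihedralPerm x 0))) ?_, fun i => ?_⟩
  · rintro x ⟨c, hc⟩
    have hc' : sigma 3 * c = c * sigma 3 := Subgroup.mem_centralizer_iff.mp hc _ rfl
    have h0 : dihedralPerm (x * c) 0 = dihedralPerm x 0 := by
      clear hc
      revert x c
      decide
    ext
    simp [h0, chi, smul_smul, mul_comm]
  · have h1 : dihedralSign k 3 (.r i) = 1 := rfl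
    rw [v2_eq, MSpace.lift_tmul]
    simp [h1, dihedralPerm]

theorem span_v2 : Submodule.span k (Set.range (v2 k 3)) = ⊤ := by
  rw [← Submodule.ker_mkQ (Submodule.span k (Set.range (v2 k 3))), LinearMap.ker_eq_top]
  apply MSpace.hom_ext
  have h : ∀ i w, MSpace.tmul (sigma 3) (chi k 3) (.r i) w ∈
      Submodule.span k (Set.range (v2 k 3)) := by
    intro i w
    have : MSpace.tmul (sigma 3) (chi k 3) (.r i) w = w • v2 k 3 i := by
      rw [v2_eq, MSpace.tmul, MSpace.tmul, ← map_smul, smul_eq_mul, mul_one]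
    rw [this]
    exact Submodule.smul_mem _ _ (Submodule.subset_span ⟨i, rfl⟩)
  intro x w
  simp only [Submodule.mkQ_apply, LinearMap.zero_apply, Submodule.Quotient.mk_eq_zero]
  rcases x with i | i
  · exact h i w
  · rw [tmul_sr]
    exact h _ _

theorem range_j2 : LinearMap.range (j2 k 3) = Submodule.span k (Set.range (y k 3)) := by
  rw [LinearMap.range_eq_map, ← span_v2, Submodule.map_span, ← Set.range_comp]
  rfl

theorem ringQuot_adjoin_eq_top {V : Type*} [AddCommGroup V] [Module k V]
    (r : TensorAlgebra k V → TensorAlgebra k V → Prop) {s : Set (RingQuot r)}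
    (h : LinearMap.range ((RingQuot.mkAlgHom k r).toLinearMap ∘ₗ TensorAlgebra.ι k) =
      Submodule.span k s) : Algebra.adjoin k s = ⊤ := by
  rw [← Algebra.adjoin_span, ← h, LinearMap.coe_range, LinearMap.coe_comp, Set.range_comp]
  erw [← AlgHom.map_adjoin]
  rw [TensorAlgebra.adjoin_range_ι, Algebra.map_top, AlgHom.range_eq_top]
  exact RingQuot.mkAlgHom_surjective k r

theorem isQuadraticPresentation_R2 : IsQuadraticPresentation k fkRels (y k 3) where
  sum_eq_zero := by
    refine forall_mem_fkRels.2 ⟨fun i => ?_, fun s hs => ?_⟩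
    · have := RingQuot.mkAlgHom_rel k (Rel2.sq (k := k) (p := 3) i)
      rw [map_mul, map_zero] at this
      rw [Multiset.map_singleton, Multiset.sum_singleton]
      exact this
    · have := RingQuot.mkAlgHom_rel k (Rel2.sum (k := k) (p := 3) s hs)
      simp only [map_sum, map_mul, map_zero] at this
      rw [Multiset.map_map]
      exact this
  exists_lift {B} _ _ f hf := by
    obtain ⟨hf₁, hf₂⟩ := forall_mem_fkRels.1 hf
    obtain ⟨F, hF⟩ := exists_linearMap_v2 k f
    have hF' : ∀ i, TensorAlgebra.lift k F (t2 k 3 i) = f i := fun i => by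
      rw [t2, TensorAlgebra.lift_ι_apply, hF]
    refine ⟨RingQuot.liftAlgHom k ⟨TensorAlgebra.lift k F, ?_⟩, fun i => ?_⟩
    · rintro _ _ (i | ⟨s, hs⟩)
      · simpa [hF'] using hf₁ i
      · have := hf₂ s hs
        rw [Multiset.map_map] at this
        simp only [map_sum, map_mul, map_zero, hF']
        exact this
    · rw [← hF']
      exact RingQuot.liftAlgHom_mkAlgHom_apply ..
  adjoin_eq_top := ringQuot_adjoin_eq_top k _ (range_j2 k)

end DihedralPresentation

/-! ### The presentation of `R¹₃` -/

section SymmetricPresentation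

variable (k : Type u) [Field k]

theorem isSwap_swapFixing (i : ZMod 3) : (swapFixing i).IsSwap :=
  ⟨_, _, by revert i; decide, rfl⟩

/-- The transposition that fixes `i`, as a transposition. -/
def transpositionFixing (i : ZMod 3) : Transposition 3 := ⟨swapFixing i, isSwap_swapFixing i⟩

theorem exists_transpositionFixing (τ : Transposition 3) : ∃ i, τ = transpositionFixing i := by
  have : ∀ a b : Fin 3, a ≠ b → ∃ i, Equiv.swap a b = swapFixing i := by decide
  obtain ⟨τ, a, b, hab, rfl⟩ := τ
  obtain ⟨i, hi⟩ := this a b hab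
  exact ⟨i, Subtype.ext hi⟩

theorem transpositionFixing_injective : Function.Injective transpositionFixing := by
  have : ∀ i j, swapFixing i = swapFixing j → i = j := by decide
  exact fun i j h => this i j (congrArg Subtype.val h)

/-- Transpositions are indexed by their fixed points. -/
def fixedPointEquiv : ZMod 3 ≃ Transposition 3 :=
  Equiv.ofBijective transpositionFixing
    ⟨transpositionFixing_injective, fun τ => (exists_transpositionFixing τ).imp fun _ => Eq.symm⟩

/-- The generators of `R¹₃`, indexed by `ℤ/3`. -/
def y1 (i : ZMod 3) : R1 k 3 := j1 k 3 (Finsupp.single (transpositionFixing i) 1)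

theorem range_j1 : LinearMap.range (j1 k 3) = Submodule.span k (Set.range (y1 k)) := by
  have : Submodule.span k (Set.range fun i => Finsupp.single (transpositionFixing i) (1 : k)) =
      ⊤ := by
    rw [← (Finsupp.basisSingleOne (R := k) (ι := Transposition 3)).span_eq]
    congr 1
    ext v
    constructor
    · rintro ⟨i, rfl⟩
      exact ⟨transpositionFixing i, by simp⟩
    · rintro ⟨τ, rfl⟩
      obtain ⟨i, rfl⟩ := exists_transpositionFixing τ
      exact ⟨i, by simp⟩
  rw [LinearMap.range_eq_map, ← this, Submodule.map_span, ← Set.range_comp]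
  rfl

theorem isQuadraticPresentation_R1 : IsQuadraticPresentation k fkRels (y1 k) where
  sum_eq_zero := by
    refine forall_mem_fkRels.2 ⟨fun i => ?_, fun s hs => ?_⟩
    · have := RingQuot.mkAlgHom_rel k (Rel1.sq (k := k) (n := 3) (transpositionFixing i))
      rw [map_mul, map_zero] at this
      rw [Multiset.map_singleton, Multiset.sum_singleton]
      exact this
    -- One braid relation per `s` suffices: steps of size `s` from `0` run once around `ℤ/3`.
    · have h : swapFixing 0 * swapFixing s = swapFixing (2 * s) * swapFixing 0 := by
        revert s
        decide
      have := RingQuot.mkAlgHom_rel k (Rel1.braid (k := k) (n := 3) (transpositionFixing 0)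
        (transpositionFixing s) (transpositionFixing (2 * s)) h)
      simp only [map_add, map_mul, map_zero] at this
      change y1 k 0 * y1 k s + y1 k s * y1 k (2 * s) + y1 k (2 * s) * y1 k 0 = 0 at this
      have hs' : (Finset.univ : Finset (ZMod 3)).val.map (fun i => (i, i + s)) =
          {(0, s), (s, 2 * s), (2 * s, 0)} := by
        clear this h
        revert s
        decide
      rw [hs']
      simpa [add_assoc] using this
  exists_lift {B} _ _ f hf := by
    obtain ⟨hf₁, hf₂⟩ := forall_mem_fkRels.1 hf
    simp only [Multiset.map_singleton, Multiset.sum_singleton] at hf₁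
    let F : (Transposition 3 →₀ k) →ₗ[k] B :=
      Finsupp.linearCombination k fun τ => f (fixedPointEquiv.symm τ)
    have hF' : ∀ i, TensorAlgebra.lift k F (t1 k 3 (transpositionFixing i)) = f i := fun i => by
      have : fixedPointEquiv.symm (transpositionFixing i) = i := fixedPointEquiv.symm_apply_apply i
      simp [t1, F, this]
    refine ⟨RingQuot.liftAlgHom k ⟨TensorAlgebra.lift k F, ?_⟩, fun i => ?_⟩
    · rintro _ _ (τ | ⟨τ, τ', h⟩ | ⟨τ, τ', τ'', h⟩)
      · obtain ⟨i, rfl⟩ := exists_transpositionFixing τ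
        simp [hF', hf₁]
      · obtain ⟨i, rfl⟩ := exists_transpositionFixing τ
        obtain ⟨j, rfl⟩ := exists_transpositionFixing τ'
        -- Commuting transpositions of three points coincide, so this relation reads `2 y_i² = 0`.
        have : i = j := by
          change swapFixing i * swapFixing j = swapFixing j * swapFixing i at h
          revert i j
          decide
        subst this
        simp [hF', hf₁]
      · obtain ⟨i, rfl⟩ := exists_transpositionFixing τ
        obtain ⟨j, rfl⟩ := exists_transpositionFixing τ'
        obtain ⟨l, rfl⟩ := exists_transpositionFixing τ''
        have h : swapFixing i * swapFixing j = swapFixing l * swapFixing i := h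
        rcases eq_or_ne i j with rfl | hij
        · have : i = l := by
            revert i l
            decide
          subst this
          simp [hF', hf₁]
        · have hs' : (Finset.univ : Finset (ZMod 3)).val.map (fun i' => (i', i' + (j - i))) =
              {(i, j), (j, l), (l, i)} := by
            revert i j l
            decide
          have := hf₂ (j - i) (sub_ne_zero.2 hij.symm)
          rw [hs'] at this
          simpa [hF', add_assoc] using this
    · rw [← hF']
      exact RingQuot.liftAlgHom_mkAlgHom_apply ..
  adjoin_eq_top := ringQuot_adjoin_eq_top k _ (range_j1 k)

end SymmetricPresentation

/-! ### The monomial basis and the Nichols property -/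

section FominKirillovBasis

variable {k : Type u} [Field k] {R : Type u} [Ring R] [Algebra k R] {y : ZMod 3 → R}

/-- The monomials that form a basis of the algebra with the relations `fkRels`. -/
def fkMonomial (y : ZMod 3 → R) : Fin 12 → R :=
  ![1, y 0, y 1, y 2, y 0 * y 1, y 1 * y 2, y 0 * y 2, y 1 * y 0,
    y 0 * y 1 * y 0, y 0 * y 1 * y 2, y 1 * y 0 * y 2, y 0 * y 1 * y 0 * y 2]

/-- The degrees of the monomials in `fkMonomial`. -/
def fkDegree : Fin 12 → ℕ := ![0, 1, 1, 1, 2, 2, 2, 2, 3, 3, 3, 4]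

theorem fkMonomial_mem_span_pow (j : Fin 12) :
    fkMonomial y j ∈ Submodule.span k (Set.range y) ^ fkDegree j := by
  have h0 : (1 : R) ∈ Submodule.span k (Set.range y) ^ 0 := Submodule.one_le.1 (pow_zero _).ge
  have h1 := fun a => gen_mul_mem_span_pow (y := y) a h0
  have h2 := fun a b => gen_mul_mem_span_pow (y := y) a (h1 b)
  have h3 := fun a b c => gen_mul_mem_span_pow (y := y) a (h2 b c)
  have h4 := fun a b c d => gen_mul_mem_span_pow (y := y) a (h3 b c d)
  simp only [mul_one, zero_add, Nat.reduceAdd] at h1 h2 h3 h4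
  fin_cases j <;> simp only [fkMonomial, fkDegree, mul_assoc] <;>
    first | exact h0 | exact h1 _ | exact h2 _ _ | exact h3 _ _ _ | exact h4 _ _ _ _

variable (P : IsQuadraticPresentation k fkRels y)

include P

theorem fk_sq (i : ZMod 3) : y i * y i = 0 := by
  simpa using (forall_mem_fkRels.1 P.sum_eq_zero).1 i

theorem fk_sq_assoc (i : ZMod 3) (a : R) : y i * (y i * a) = 0 := by
  rw [← mul_assoc, fk_sq P, zero_mul]

theorem fk_20 : y 2 * y 0 = -(y 0 * y 1) - y 1 * y 2 := by
  have h : y 0 * y 1 + (y 1 * y 2 + y 2 * y 0) = 0 := by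
    have := (forall_mem_fkRels.1 P.sum_eq_zero).2 1 (by decide)
    rw [show (Finset.univ : Finset (ZMod 3)).val.map (fun i => (i, i + 1)) =
      {(0, 1), (1, 2), (2, 0)} by decide] at this
    simpa using this
  rw [← sub_eq_zero, ← h]
  abel

theorem fk_21 : y 2 * y 1 = -(y 0 * y 2) - y 1 * y 0 := by
  have h : y 0 * y 2 + (y 1 * y 0 + y 2 * y 1) = 0 := by
    have := (forall_mem_fkRels.1 P.sum_eq_zero).2 2 (by decide)
    rw [show (Finset.univ : Finset (ZMod 3)).val.map (fun i => (i, i + 2)) =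
      {(0, 2), (1, 0), (2, 1)} by decide] at this
    simpa using this
  rw [← sub_eq_zero, ← h]
  abel

/-- The cubic rules complete the rewriting system. The overlap `y₂y₀y₀` gives the braid relation
`fk_101`, and `y₂y₂y₀` gives `fk_201`; the others are direct substitutions. -/
theorem fk_020 : y 0 * (y 2 * y 0) = -(y 0 * (y 1 * y 2)) := by
  rw [fk_20 P, mul_sub, mul_neg, fk_sq_assoc P, neg_zero, zero_sub]

theorem fk_101 : y 1 * (y 0 * y 1) = y 0 * (y 1 * y 0) := by
  have h1 : y 1 * (y 2 * y 0) = -(y 1 * (y 0 * y 1)) := by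
    rw [fk_20 P, mul_sub, mul_neg, fk_sq_assoc P, sub_zero]
  have h2 : y 2 * y 0 * y 0 = 0 := by rw [mul_assoc, fk_sq P, mul_zero]
  rw [fk_20 P, sub_mul, neg_mul, mul_assoc, mul_assoc, h1, sub_neg_eq_add, neg_add_eq_zero] at h2
  exact h2.symm

theorem fk_212 : y 2 * (y 1 * y 2) = -(y 1 * (y 0 * y 2)) := by
  rw [← mul_assoc, fk_21 P, sub_mul, neg_mul, mul_assoc, fk_sq P, mul_zero, neg_zero, zero_sub,
    mul_assoc]

theorem fk_201 : y 2 * (y 0 * y 1) = y 1 * (y 0 * y 2) := by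
  have h : y 2 * (y 2 * y 0) = 0 := fk_sq_assoc P 2 _
  rw [fk_20 P, mul_sub, mul_neg, fk_212 P, sub_neg_eq_add, neg_add_eq_zero] at h
  exact h

theorem fk_202 : y 2 * (y 0 * y 2) = -(y 0 * (y 1 * y 2)) := by
  rw [← mul_assoc, fk_20 P, sub_mul, neg_mul, mul_assoc, mul_assoc, fk_sq P, mul_zero, sub_zero]

theorem fk_210 : y 2 * (y 1 * y 0) = y 0 * (y 1 * y 2) := by
  rw [← mul_assoc, fk_21 P, sub_mul, neg_mul, mul_assoc, mul_assoc, fk_sq P, mul_zero, sub_zero,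
    fk_020 P, neg_neg]

theorem fk_101_assoc (a : R) : y 1 * (y 0 * (y 1 * a)) = y 0 * (y 1 * (y 0 * a)) := by
  simpa only [mul_assoc] using congrArg (· * a) (fk_101 P)

theorem fk_201_assoc (a : R) : y 2 * (y 0 * (y 1 * a)) = y 1 * (y 0 * (y 2 * a)) := by
  simpa only [mul_assoc] using congrArg (· * a) (fk_201 P)

theorem fk_210_assoc (a : R) : y 2 * (y 1 * (y 0 * a)) = y 0 * (y 1 * (y 2 * a)) := by
  simpa only [mul_assoc] using congrArg (· * a) (fk_210 P)

/-- This yields both spanning and the grading. For the top monomial the target is the span of the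
empty set, so it includes the vanishing in degree five. -/
theorem gen_mul_fkMonomial_mem (x : ZMod 3) (j : Fin 12) :
    y x * fkMonomial y j ∈
      Submodule.span k (fkMonomial y '' {i | fkDegree i = fkDegree j + 1}) := by
  set N : ℕ → Submodule k R := fun d => Submodule.span k (fkMonomial y '' {i | fkDegree i = d})
  have hN : ∀ i, fkMonomial y i ∈ N (fkDegree i) := fun i =>
    Submodule.subset_span ⟨i, rfl, rfl⟩
  change _ ∈ N _
  have h1 : y 0 ∈ N 1 := hN 1
  have h2 : y 1 ∈ N 1 := hN 2
  have h3 : y 2 ∈ N 1 := hN 3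
  have h4 : y 0 * y 1 ∈ N 2 := hN 4
  have h5 : y 1 * y 2 ∈ N 2 := hN 5
  have h6 : y 0 * y 2 ∈ N 2 := hN 6
  have h7 : y 1 * y 0 ∈ N 2 := hN 7
  have h8 : y 0 * (y 1 * y 0) ∈ N 3 := by rw [← mul_assoc]; exact hN 8
  have h9 : y 0 * (y 1 * y 2) ∈ N 3 := by rw [← mul_assoc]; exact hN 9
  have h10 : y 1 * (y 0 * y 2) ∈ N 3 := by rw [← mul_assoc]; exact hN 10
  have h11 : y 0 * (y 1 * (y 0 * y 2)) ∈ N 4 := by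
    simp only [← mul_assoc]
    exact hN 11
  have h20 : y 2 * y 0 ∈ N 2 := by
    rw [fk_20 P]
    exact sub_mem (neg_mem h4) h5
  have h21 : y 2 * y 1 ∈ N 2 := by
    rw [fk_21 P]
    exact sub_mem (neg_mem h6) h7
  obtain rfl | rfl | rfl : x = 0 ∨ x = 1 ∨ x = 2 := by
    revert x
    decide
  all_goals fin_cases j <;>
    simp [fkMonomial, fkDegree, mul_assoc, fk_sq P, fk_sq_assoc P, fk_020 P, fk_101 P,
      fk_212 P, fk_201 P, fk_202 P, fk_210 P, fk_101_assoc P, fk_201_assoc P, fk_210_assoc P,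
      neg_mem_iff, h1, h2, h3, h4, h5, h6, h7, h8, h9, h10, h11, h20, h21]

theorem span_pow_eq (d : ℕ) : Submodule.span k (Set.range y) ^ d =
    Submodule.span k (fkMonomial y '' {i | fkDegree i = d}) := by
  apply le_antisymm
  · refine span_pow_le
      (N := fun d => Submodule.span k (fkMonomial y '' {i | fkDegree i = d})) ?_ ?_ d
    · exact Submodule.subset_span ⟨0, rfl, rfl⟩
    · intro d x a ha
      induction ha using Submodule.span_induction with
      | mem a ha =>
        obtain ⟨j, rfl, rfl⟩ := ha
        exact gen_mul_fkMonomial_mem P x j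
      | zero => simp
      | add a b _ _ ha hb => rw [mul_add]; exact add_mem ha hb
      | smul c a _ ha => rw [mul_smul_comm]; exact Submodule.smul_mem _ _ ha
  · rw [Submodule.span_le]
    rintro _ ⟨j, rfl, rfl⟩
    exact fkMonomial_mem_span_pow j

theorem span_fkMonomial : Submodule.span k (Set.range (fkMonomial y)) = ⊤ := by
  refine P.eq_top_of_left_stable (Submodule.subset_span ⟨0, rfl⟩) fun x a ha => ?_
  induction ha using Submodule.span_induction with
  | mem a ha =>
    obtain ⟨j, rfl⟩ := ha
    exact Submodule.span_mono (Set.image_subset_range _ _) (gen_mul_fkMonomial_mem P x j)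
  | zero => simp
  | add a b _ _ ha hb => rw [mul_add]; exact add_mem ha hb
  | smul c a _ ha => rw [mul_smul_comm]; exact Submodule.smul_mem _ _ ha

/-- The functional `ε ∂ⱼ ⋯ ∂ᵢ` for a list `[i, …, j]`. -/
def wordFunctional : List (ZMod 3) → R →ₗ[k] k
  | [] => P.counit.toLinearMap
  | i :: w => wordFunctional w ∘ₗ (dihedralDatum k).skewDer P (P.coord i)

/-- The dual basis of `fkMonomial`. -/
def fkDual : Fin 12 → R →ₗ[k] k :=
  -- The first letter differentiates first. Signs come from the action, as in `∂₀(y₀y₁) = -y₂`. The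
  -- words make the pairing exactly diagonal: `[1, 0]`, for instance, is nonzero on both `y₀y₁` and
  -- `y₁y₂`.
  ![wordFunctional P [], wordFunctional P [0], wordFunctional P [1], wordFunctional P [2],
    -wordFunctional P [0, 2], wordFunctional P [2, 1], wordFunctional P [2, 0],
    -wordFunctional P [1, 2], wordFunctional P [0, 1, 0], wordFunctional P [2, 1, 0],
    wordFunctional P [2, 0, 1], wordFunctional P [2, 0, 1, 0]]

theorem skewDer_coord_gen_mul (i x : ZMod 3) (a : R) :
    (dihedralDatum k).skewDer P (P.coord i) (y x * a) =
      y x * (dihedralDatum k).skewDer P (P.coord i) a +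
        (if x = i then (1 : k) else 0) • (dihedralDatum k).act P (.sr x) a := by
  rw [BraidedQuadraticDatum.skewDer_gen_mul _ _ (P.coord_gen_mul i), P.coord_gen]
  rfl

theorem skewDer_coord_one (i : ZMod 3) : (dihedralDatum k).skewDer P (P.coord i) 1 = 0 :=
  BraidedQuadraticDatum.skewDer_one _ _ _ (P.coord_one i)

theorem skewDer_coord_gen (i x : ZMod 3) :
    (dihedralDatum k).skewDer P (P.coord i) (y x) = (if x = i then (1 : k) else 0) • 1 := by
  have := skewDer_coord_gen_mul P i x 1
  rwa [mul_one, skewDer_coord_one, mul_zero, zero_add, BraidedQuadraticDatum.act_one] at this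

theorem act_sr_gen (x x' : ZMod 3) :
    (dihedralDatum k).act P (.sr x) (y x') = -y (-(x + x')) :=
  (dihedralDatum k).act_deg_gen P x x'

set_option maxHeartbeats 1000000 in
theorem fkDual_fkMonomial (i j : Fin 12) :
    fkDual P i (fkMonomial y j) = if i = j then 1 else 0 := by
  have h00 : (dihedralDatum k).act P (.sr 0) (y 0) = -y 0 := act_sr_gen P 0 0
  have h01 : (dihedralDatum k).act P (.sr 0) (y 1) = -y 2 := act_sr_gen P 0 1
  have h02 : (dihedralDatum k).act P (.sr 0) (y 2) = -y 1 := act_sr_gen P 0 2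
  have h10 : (dihedralDatum k).act P (.sr 1) (y 0) = -y 2 := act_sr_gen P 1 0
  have h11 : (dihedralDatum k).act P (.sr 1) (y 1) = -y 1 := act_sr_gen P 1 1
  have h12 : (dihedralDatum k).act P (.sr 1) (y 2) = -y 0 := act_sr_gen P 1 2
  have h20 : (dihedralDatum k).act P (.sr 2) (y 0) = -y 1 := act_sr_gen P 2 0
  have h21 : (dihedralDatum k).act P (.sr 2) (y 1) = -y 0 := act_sr_gen P 2 1
  have e01 : (0 : ZMod 3) ≠ 1 := by decide
  have e02 : (0 : ZMod 3) ≠ 2 := by decide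
  have e12 : (1 : ZMod 3) ≠ 2 := by decide
  fin_cases j <;> fin_cases i <;>
    simp [fkDual, fkMonomial, wordFunctional, mul_assoc, skewDer_coord_gen_mul, skewDer_coord_one,
      skewDer_coord_gen, BraidedQuadraticDatum.act_mul, h00, h01, h02, h10, h11, h12, h20, h21,
      e01, e02, e12, e01.symm, e02.symm, e12.symm]

theorem linearIndependent_fkMonomial : LinearIndependent k (fkMonomial y) := by
  rw [Fintype.linearIndependent_iff]
  intro c hc i
  have := congrArg (fkDual P i) hc
  simpa [fkDual_fkMonomial] using this

/-- The basis of monomials. -/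
def fkBasis : Module.Basis (Fin 12) k R :=
  Module.Basis.mk (linearIndependent_fkMonomial P) (span_fkMonomial P).ge

theorem coe_fkBasis : ⇑(fkBasis P) = fkMonomial y := Module.Basis.coe_mk _ _

theorem fkBasis_repr (a : R) (i : Fin 12) : (fkBasis P).repr a i = fkDual P i a := by
  have : (fkBasis P).coord i = fkDual P i := (fkBasis P).ext fun j => by
    rw [coe_fkBasis, fkDual_fkMonomial, ← coe_fkBasis P, Module.Basis.coord_apply,
      Module.Basis.repr_self, Finsupp.single_apply]
    simp only [eq_comm]
  exact LinearMap.congr_fun this a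

theorem finrank_span_pow (d : ℕ) :
    Module.finrank k ↥(Submodule.span k (Set.range y) ^ d) =
      (Finset.univ.filter fun i => fkDegree i = d).card := by
  have h := (linearIndependent_fkMonomial P).comp
    (Subtype.val : {i // fkDegree i = d} → Fin 12) Subtype.val_injective
  have := finrank_span_eq_card h
  rw [Set.range_comp, Subtype.range_coe_subtype, ← span_pow_eq P] at this
  rw [this, Fintype.card_subtype]

theorem isInternal_span_pow :
    DirectSum.IsInternal fun d : ℕ => Submodule.span k (Set.range y) ^ d := by
  apply DirectSum.isInternal_submodule_of_iSupIndep_of_iSup_eq_top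
  · intro d
    simp only [span_pow_eq P]
    refine Disjoint.mono_right (iSup₂_le fun e he => ?_)
      ((linearIndependent_fkMonomial P).disjoint_span_image
        (s := {i | fkDegree i = d}) (t := {i | fkDegree i ≠ d}) ?_)
    · exact Submodule.span_mono (Set.image_mono fun i hi => fun h => he (hi.symm.trans h))
    · exact Set.disjoint_left.2 fun i hi hi' => hi' hi
  · rw [eq_top_iff, ← span_fkMonomial P, Submodule.span_le]
    rintro _ ⟨j, rfl⟩
    exact Submodule.mem_iSup_of_mem (fkDegree j) (fkMonomial_mem_span_pow j)

/-- The first derivative of a primitive element is a scalar, and the second one kills it. -/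
theorem wordFunctional_of_mem_primitives {a : R}
    (ha : a ∈ ((dihedralDatum k).hopf P).primitives) (i j : ZMod 3) (w : List (ZMod 3)) :
    wordFunctional P (i :: j :: w) a = 0 := by
  simp only [wordFunctional, LinearMap.comp_apply]
  rw [BraidedQuadraticDatum.skewDer_of_mem_primitives _ _ (P.coord_one i) ha, map_smul,
    skewDer_coord_one, smul_zero, map_zero]

theorem primitives_eq_span :
    ((dihedralDatum k).hopf P).primitives = Submodule.span k (Set.range y) ^ 1 := by
  apply le_antisymm
  · intro a ha
    rw [span_pow_eq P, ← coe_fkBasis P, Module.Basis.mem_span_image]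
    intro i hi
    rw [Finset.mem_coe, Finsupp.mem_support_iff, fkBasis_repr] at hi
    by_contra hd
    apply hi
    have h0 : P.counit a = 0 := BraidedQuadraticDatum.counit_of_mem_primitives _ _ ha
    have h := wordFunctional_of_mem_primitives P ha
    fin_cases i <;> first | exact absurd rfl hd | exact h0 | exact h _ _ _ | skip
    -- The two dual functionals that carry a minus sign.
    all_goals exact (congrArg Neg.neg (h _ _ _)).trans neg_zero
  · rw [pow_one, Submodule.span_le]
    rintro _ ⟨x, rfl⟩
    exact BraidedQuadraticDatum.gen_mem_primitives _ _ x

theorem isTOBA_hopf :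
    IsTOBA ((dihedralDatum k).hopf P) fun d => Submodule.span k (Set.range y) ^ d where
  toIsGradedHopf := (dihedralDatum k).isGradedHopf P (isInternal_span_pow P)
  zero_equiv := by
    have := Module.Finite.of_basis (fkBasis P)
    refine ⟨LinearEquiv.ofFinrankEq _ _ ?_⟩
    rw [finrank_span_pow P, Module.finrank_self]
    rfl
  sq_eq := iSup_pow_sq _
  primitives_eq := primitives_eq_span P

end FominKirillovBasis

/-! ### Agreement with the structures inherited from the tensor algebras -/

section Inherited

variable (k : Type u) [Field k]

theorem mem_of_mem_range {V : Type*} [AddCommGroup V] [Module k V] {R : Type*} [AddCommGroup R]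
    [Module k R] {j : V →ₗ[k] R} {s : Set R} {N : Submodule k R}
    (h : LinearMap.range j = Submodule.span k s) (hs : s ⊆ N) (v : V) : j v ∈ N :=
  Submodule.span_le.2 hs (h ▸ LinearMap.mem_range_self j v)

theorem isInherited_R2 :
    ((dihedralDatum k).hopf (isQuadraticPresentation_R2 k)).IsInherited (V2 k 3) (j2 k 3) := by
  refine ⟨⟨fun g => ?_, ?_⟩, mem_of_mem_range k (range_j2 k) ?_⟩
  · refine LinearMap.ext_on (span_v2 k) ?_
    rintro _ ⟨i, rfl⟩
    have h1 := (dihedralDatum k).act_gen (isQuadraticPresentation_R2 k) g i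
    change j2 k 3 ((V2 k 3).act g (v2 k 3 i)) =
      (dihedralDatum k).act (isQuadraticPresentation_R2 k) g (y k 3 i)
    rw [h1, act_v2, map_smul]
    rfl
  · refine LinearMap.ext_on (span_v2 k) ?_
    rintro _ ⟨i, rfl⟩
    have h1 := (dihedralDatum k).coact_gen (isQuadraticPresentation_R2 k) i
    have h2 := MSpace.coact_tmul (sigma 3) (chi k 3) (.r i) 1
    -- The conjugate is `sr (-2i)`, and `-2 = 1` in `ℤ/3`.
    have h3 : DihedralGroup.r i * sigma 3 * (DihedralGroup.r i)⁻¹ = .sr i := by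
      clear h1 h2
      revert i
      decide
    rw [← v2_eq, h3] at h2
    change (dihedralDatum k).coact (isQuadraticPresentation_R2 k) (y k 3 i) =
      (j2 k 3).lTensor _ (MSpace.coact (sigma 3) (chi k 3) (v2 k 3 i))
    rw [h1, h2]
    rfl
  · rintro _ ⟨i, rfl⟩
    exact BraidedQuadraticDatum.gen_mem_primitives _ _ i

theorem isInherited_R1 :
    ((symmetricDatum k).hopf (isQuadraticPresentation_R1 k)).IsInherited (V1 k 3) (j1 k 3) := by
  refine ⟨⟨fun g => ?_, ?_⟩, mem_of_mem_range k (range_j1 k) ?_⟩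
  · ext τ
    obtain ⟨i, rfl⟩ := exists_transpositionFixing τ
    have h1 := (symmetricDatum k).act_gen (isQuadraticPresentation_R1 k) g i
    have h2 : Transposition.conj g (transpositionFixing i) =
        transpositionFixing (g i) := Subtype.ext ((symmetricDatum k).deg_perm g i).symm
    have h3 : (V1 k 3).act g (Finsupp.single (transpositionFixing i) 1) =
        ((Equiv.Perm.sign g : ℤ) : k) • Finsupp.single (transpositionFixing (g i)) 1 := by
      rw [← h2]
      simp [V1]
    change j1 k 3 ((V1 k 3).act g (Finsupp.single (transpositionFixing i) 1)) =
      (symmetricDatum k).act (isQuadraticPresentation_R1 k) g (y1 k i)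
    rw [h1, h3, map_smul]
    rfl
  · ext τ
    obtain ⟨i, rfl⟩ := exists_transpositionFixing τ
    have h1 := (symmetricDatum k).coact_gen (isQuadraticPresentation_R1 k) i
    have h3 : (V1 k 3).coact (Finsupp.single (transpositionFixing i) 1) =
        MonoidAlgebra.of k _ (swapFixing i) ⊗ₜ Finsupp.single (transpositionFixing i) 1 := by
      simp [V1, transpositionFixing]
    change (symmetricDatum k).coact (isQuadraticPresentation_R1 k) (y1 k i) =
      (j1 k 3).lTensor _ ((V1 k 3).coact (Finsupp.single (transpositionFixing i) 1))
    rw [h1, h3]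
    rfl
  · rintro _ ⟨i, rfl⟩
    exact BraidedQuadraticDatum.gen_mem_primitives _ _ i

end Inherited

/-! ### The isomorphism of the two algebras -/

section Isomorphism

variable {k : Type u} [Field k] {X : Type*} {R R' : Type u} [Ring R] [Algebra k R]
  [Ring R'] [Algebra k R'] {rels : Set (Multiset (X × X))} {y : X → R} {y' : X → R'}

/-- Algebras with the same quadratic presentation are isomorphic. -/
def IsQuadraticPresentation.equiv (P : IsQuadraticPresentation k rels y)
    (P' : IsQuadraticPresentation k rels y') : R ≃ₐ[k] R' :=
  AlgEquiv.ofAlgHom (P.lift y' P'.sum_eq_zero) (P'.lift y P.sum_eq_zero)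
    (P'.algHom_ext fun x => by simp) (P.algHom_ext fun x => by simp)

theorem IsQuadraticPresentation.equiv_gen (P : IsQuadraticPresentation k rels y)
    (P' : IsQuadraticPresentation k rels y') (x : X) : P.equiv P' (y x) = y' x :=
  P.lift_apply _ _ _

theorem map_span_pow {F : R →ₐ[k] R'} (hF : ∀ x, F (y x) = y' x) (d : ℕ) :
    (Submodule.span k (Set.range y) ^ d).map F.toLinearMap =
      Submodule.span k (Set.range y') ^ d := by
  rw [Submodule.map_pow, Submodule.map_span, ← Set.range_comp]
  congr
  funext x
  exact hF x

end Isomorphism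

theorem dihedralSign_eq_sign (k : Type u) [Field k] (g : DihedralGroup 3) :
    ((Equiv.Perm.sign (dihedralEquivPerm g) : ℤ) : k) = dihedralSign k 3 g := by
  rcases g with a | a
  · have : Equiv.Perm.sign (dihedralEquivPerm (.r a)) = 1 := by
      revert a
      decide
    rw [this, Units.val_one, Int.cast_one]
    rfl
  · have : Equiv.Perm.sign (dihedralEquivPerm (.sr a)) = -1 := by
      revert a
      decide
    rw [this, Units.val_neg, Units.val_one, Int.cast_neg, Int.cast_one]
    rfl

theorem swapFixing_eq (i : ZMod 3) : swapFixing i = dihedralEquivPerm (.sr i) := by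
  revert i
  decide

end YetterDrinfeld

end

open YetterDrinfeld in
theorem mainTheorem2 (k : Type*) [Field k] :
    ∃ (T₁ : YDHopfAlgebra k (Equiv.Perm (Fin 3)) (R1 k 3))
      (T₂ : YDHopfAlgebra k (DihedralGroup 3) (R2 k 3)),
      T₁.IsInherited (V1 k 3) (j1 k 3) ∧
      T₂.IsInherited (V2 k 3) (j2 k 3) ∧
      -- `R²₃` and `R¹₃` are isomorphic as graded braided Hopf algebras, along `D₃ ≃ S₃`
      (∃ (φ : DihedralGroup 3 ≃* Equiv.Perm (Fin 3)) (F : R2 k 3 ≃ₐ[k] R1 k 3),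
        IsYDHomAlong φ.toMonoidHom T₂.toYDData T₁.toYDData F.toLinearMap ∧
        T₁.comul ∘ₗ F.toLinearMap = TensorProduct.map F.toLinearMap F.toLinearMap ∘ₗ T₂.comul ∧
        T₁.counit ∘ₗ F.toLinearMap = T₂.counit ∧
        ∀ d, (grade2 k 3 d).map F.toLinearMap = grade1 k 3 d) ∧
      -- `R²₃` is a TOBA of dimension 12
      IsTOBA T₂ (grade2 k 3) ∧
      Module.finrank k (R2 k 3) = 12 ∧
      -- the Hilbert series is `1 + 3t + 4t² + 3t³ + t⁴`
      Module.finrank k (grade2 k 3 0) = 1 ∧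
      Module.finrank k (grade2 k 3 1) = 3 ∧
      Module.finrank k (grade2 k 3 2) = 4 ∧
      Module.finrank k (grade2 k 3 3) = 3 ∧
      Module.finrank k (grade2 k 3 4) = 1 ∧
      (∀ d, 5 ≤ d → grade2 k 3 d = ⊥) ∧
      -- the explicit basis
      ∃ b : Module.Basis (Fin 12) k (R2 k 3),
        ⇑b = ![1, y k 3 0, y k 3 1, y k 3 2,
          y k 3 0 * y k 3 1, y k 3 1 * y k 3 2, y k 3 0 * y k 3 2, y k 3 1 * y k 3 0,
          y k 3 0 * y k 3 1 * y k 3 0, y k 3 0 * y k 3 1 * y k 3 2, y k 3 1 * y k 3 0 * y k 3 2,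
          y k 3 0 * y k 3 1 * y k 3 0 * y k 3 2] := by
  have P₁ := isQuadraticPresentation_R1 k
  have P₂ := isQuadraticPresentation_R2 k
  have hgr₂ : grade2 k 3 = fun d => Submodule.span k (Set.range (y k 3)) ^ d := by
    funext d
    rw [grade2, range_j2]
  have hgr₁ : grade1 k 3 = fun d => Submodule.span k (Set.range (y1 k)) ^ d := by
    funext d
    rw [grade1, range_j1]
  have hF : ∀ i, (P₂.equiv P₁).toAlgHom (y k 3 i) = y1 k i := P₂.equiv_gen P₁
  -- Definitional, since the group isomorphism is the action on the vertices.
  have hp : ∀ (g : DihedralGroup 3) (i : ZMod 3), (symmetricDatum k).perm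
    (dihedralEquivPerm.toMonoidHom g) i = (dihedralDatum k).perm g i := fun _ _ => rfl
  rw [hgr₁, hgr₂]
  refine ⟨(symmetricDatum k).hopf P₁, (dihedralDatum k).hopf P₂, isInherited_R1 k,
    isInherited_R2 k, ⟨dihedralEquivPerm, P₂.equiv P₁, ?_, ?_, ?_, ?_⟩, isTOBA_hopf P₂,
    ?_, ?_, ?_, ?_, ?_, ?_, ?_, fkBasis P₂, coe_fkBasis P₂⟩
  · exact BraidedQuadraticDatum.isYDHomAlong swapFixing_eq hp (dihedralSign_eq_sign k) hF
  · exact BraidedQuadraticDatum.map_comul (φ := dihedralEquivPerm.toMonoidHom) swapFixing_eq hp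
      (dihedralSign_eq_sign k) hF
  · exact congrArg AlgHom.toLinearMap (P₂.counit_comp P₁ hF)
  · exact map_span_pow hF
  · rw [Module.finrank_eq_card_basis (fkBasis P₂), Fintype.card_fin]
  · exact finrank_span_pow P₂ 0
  · exact finrank_span_pow P₂ 1
  · exact finrank_span_pow P₂ 2
  · exact finrank_span_pow P₂ 3
  · exact finrank_span_pow P₂ 4
  · intro d hd
    have : {i | fkDegree i = d} = ∅ := by
      ext i
      have : fkDegree i < 5 := by
        revert i
        decide
      simp only [Set.mem_ofPred_eq, Set.mem_empty_iff_false, iff_false]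
      lia
    simp only [span_pow_eq P₂, this, Set.image_empty, Submodule.span_empty]
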